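/- Consider $N\ge 1$ agents $\dot x_i=Ax_i+Bu_i$, $x_i\in\mathbb R^n$, $u_i\in\mathbb R^p$, on an undirected connected graph $\mathcal G$ with adjacency entries $a_{ij}\in\{0,1\}$ ($a_{ii}=0$) and degrees $d_i=\sum_j a_{ij}$. Let $P>0$ be a symmetric solution of $PA+A^TP-PBB^TP+I=0$ (it exists if and only if $(A,B)$ is stabilizable), and put $K=-B^TP$, $\Gamma=PBB^TP$. Let $\kappa_{ij}=\kappa_{ji}$, $\varrho_{ij}=\varrho_{ji}$, $\delta,\mu,\nu$ be any positive constants. Denote by $t_k^i$ the $k$-th event instant of agent $i$, and let $\tilde x_i(t)=e^{A(t-t_k^i)}x_i(t_k^i)$ for $t\in[t_k^i,t_{k+1}^i)$ and $e_i=\tilde x_i-x_i$. The closed-loop network is $$\dot x_i=Ax_i+BK\sum_{j=1}^N c_{ij}a_{ij}(\tilde x_i-\tilde x_j),\qquad \dot c_{ij}=\kappa_{ij}a_{ij}\big[-\varrho_{ij}c_{ij}+(\tilde x_i-\tilde x_j)^T\Gamma(\tilde x_i-\tilde x_j)\big],\qquad c_{ij}(0)=c_{ji}(0),$$ with $t_0^i=0$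 and $t_{k+1}^i=\inf\{t>t_k^i : f_i(t)\ge 0\}$ ($\inf\emptyset=\infty$), where $$f_i(t)=\sum_{j=1}^N(1+\delta c_{ij})a_{ij}e_i^T\Gamma e_i-\frac14\sum_{j=1}^N a_{ij}(\tilde x_i-\tilde x_j)^T\Gamma(\tilde x_i-\tilde x_j)-\mu e^{-\nu t}$$ is evaluated with the prediction $\tilde x_i$ made from the sample at $t_k^i$; at an instant at which another agent $j$ has an event, the value of $\tilde x_j$ used in $f_i$ may be the one just before or the one just after that event. Consider any solution of this network (continuous $x_i$, $c_{ij}$, with the differential equations holding for right derivatives) on an interval $[0,T)$, $0<T\le\infty$, such that every agent has a latest event before or at every time in $[0,T)$; it is not assumed that the events do not accumulate at $T$. Then there is no Zeno behavior: every agent has only finitely many events in any bounded period of time (in particular the events do not accumulate at $T$ if $T<\infty$). The coupling weights $c_{ij}$, for edges $(i,j)$, are bounded on $[0,T)$ by a positive constant. Moreover, for every agent $i$ and every $k$ with $t_{k+1}^i<T$, the function $\sum_j a_{ij}\|BK\|\,\|\tilde x_i-\tilde x_j\|$ is bounded on $[t_k^i,t_{k+1}^i)$, and for all constants $\bar c$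 and $\sigma_i$ such that, on $[t_k^i,t_{k+1}^i)$, $|c_{ij}|\le\bar c$ for all neighbors $j$ of $i$ and $\sum_j a_{ij}\|BK\|\,\|\tilde x_i-\tilde x_j\|\le\sigma_i$, there is $\tau_k^i>0$ with $$t_{k+1}^i-t_k^i\ \ge\ \tau_k^i=\frac1{\|A\|}\ln\left(1+\frac{\|A\|}{\bar c\,\sigma_i\|K\|}\sqrt{\frac{\mu e^{-\nu(t_k^i+\tau_k^i)}}{d_i(1+\delta\bar c)}}\right),$$ where the right-hand side is read as its limit $\frac{1}{\bar c\,\sigma_i\|K\|}\sqrt{\frac{\mu e^{-\nu(t_k^i+\tau_k^i)}}{d_i(1+\delta\bar c)}}$ if $A=0$. Here $\|\cdot\|$ is the Euclidean norm of vectors and the spectral norm of matrices. -/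

import Mathlib

open scoped Matrix Matrix.Norms.L2Operator

noncomputable section

/-- The data of an event-triggered adaptive consensus network with `N` agents, states in `ℝⁿ` and
inputs in `ℝᵐ`: the communication graph, the agent dynamics `ẋᵢ = A xᵢ + B uᵢ`, the matrix `P` from
which the feedback gains are built, and the design parameters. -/
structure ConsensusNetwork (N n m : ℕ) where
  /-- the undirected communication graph -/
  G : SimpleGraph (Fin N)
  A : Matrix (Fin n) (Fin n) ℝ
  B : Matrix (Fin n) (Fin m) ℝ
  P : Matrix (Fin n) (Fin n) ℝ
  /-- adaptation rates -/
  κ : Fin N → Fin N → ℝ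
  /-- leakage coefficients of the adaptation law -/
  ϱ : Fin N → Fin N → ℝ
  δ : ℝ
  μ : ℝ
  ν : ℝ

namespace ConsensusNetwork

variable {N n m : ℕ}

/-- Feedback gain `K = -BᵀP`. -/
def K (S : ConsensusNetwork N n m) : Matrix (Fin m) (Fin n) ℝ := -(S.Bᵀ * S.P)

/-- Feedback gain `Γ = P B Bᵀ P`. -/
def Γ (S : ConsensusNetwork N n m) : Matrix (Fin n) (Fin n) ℝ := S.P * S.B * S.Bᵀ * S.P

open Classical in
/-- Entry `aᵢⱼ ∈ {0, 1}` of the adjacency matrix. -/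
def a (S : ConsensusNetwork N n m) (i j : Fin N) : ℝ := if S.G.Adj i j then 1 else 0

/-- The degree `dᵢ = ∑ⱼ aᵢⱼ` of agent `i`. -/
def deg (S : ConsensusNetwork N n m) (i : Fin N) : ℝ := ∑ j, S.a i j

/-- The standing assumptions: the graph is connected, `P > 0` solves the algebraic Riccati equation
`PA + AᵀP - PBBᵀP + I = 0`, the scalar parameters are positive, and the edge parameters are positive
and symmetric. -/
structure IsDesigned (S : ConsensusNetwork N n m) : Prop where
  connected : S.G.Connected
  posDef : S.P.PosDef
  riccati : S.P * S.A + S.Aᵀ * S.P - S.P * S.B * S.Bᵀ * S.P + 1 = 0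
  κ_pos : ∀ i j, S.G.Adj i j → 0 < S.κ i j
  κ_symm : ∀ i j, S.G.Adj i j → S.κ i j = S.κ j i
  ϱ_pos : ∀ i j, S.G.Adj i j → 0 < S.ϱ i j
  ϱ_symm : ∀ i j, S.G.Adj i j → S.ϱ i j = S.ϱ j i
  δ_pos : 0 < S.δ
  μ_pos : 0 < S.μ
  ν_pos : 0 < S.ν

/-- The model-based prediction `e^{A(t-s)} x(s)` made from the sample taken at the event instant
`s` (event instants take the value `⊤` when the event does not occur; then this is not used). -/
def hold (S : ConsensusNetwork N n m) (x : ℝ → Fin n → ℝ) (s : EReal) (t : ℝ) : Fin n → ℝ :=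
  NormedSpace.exp ((t - s.toReal) • S.A) *ᵥ x s.toReal

/-- The triggering function of agent `i` at time `t`:
`∑ⱼ (1 + δ cᵢⱼ) aᵢⱼ eᵀΓe - ¼ ∑ⱼ aᵢⱼ (x̃ᵢ - x̃ⱼ)ᵀΓ(x̃ᵢ - x̃ⱼ) - μ e^{-νt}`, `e = x̃ᵢ - xᵢ`,
as a function of the weights `cᵢⱼ = w j`, the own prediction `x̃ᵢ = p`, the own state `xᵢ = y` and
the predictions `x̃ⱼ = q j` of the other agents. -/
def trigger (S : ConsensusNetwork N n m) (i : Fin N) (w : Fin N → ℝ) (p y : Fin n → ℝ)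
    (q : Fin N → Fin n → ℝ) (t : ℝ) : ℝ :=
  ∑ j, (1 + S.δ * w j) * S.a i j * ((p - y) ⬝ᵥ S.Γ *ᵥ (p - y))
    - 1 / 4 * ∑ j, S.a i j * ((p - q j) ⬝ᵥ S.Γ *ᵥ (p - q j))
    - S.μ * Real.exp (-(S.ν * t))

/-- `S.IsExecution T x c ev xt seen`: on the time interval `[0, T)`, `0 < T ≤ ∞`, the agent states
`x i`, the coupling weights `c i j`, the event instants `ev i k` (`ev i k = ⊤` when agent `i` has
fewer than `k + 1` events in `[0, T)`) and the predictions `xt i` form a solution of the closed-loop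
event-triggered network.

`seen i j t` is the prediction of `x j` that enters the triggering function of agent `i` at time
`t`. It is `xt j t`, except that at an instant at which agent `j` itself has an event it may be
either the value just before or the value just after the broadcast of agent `j`: both orders of
(nearly) simultaneous events are allowed.

The solution lives only as long as every agent has a latest event (`cover`); event instants may
accumulate at the end `T` of the time interval. -/
structure IsExecution (S : ConsensusNetwork N n m) (T : EReal)
    (x : Fin N → ℝ → Fin n → ℝ) (c : Fin N → Fin N → ℝ → ℝ) (ev : Fin N → ℕ → EReal)
    (xt : Fin N → ℝ → Fin n → ℝ) (seen : Fin N → Fin N → ℝ → Fin n → ℝ) : Prop where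
  T_pos : 0 < T
  /-- initial symmetry of the coupling weights -/
  c_symm : ∀ i j, S.G.Adj i j → c i j 0 = c j i 0
  /-- the first event of each agent is at time `0` -/
  ev_zero : ∀ i, ev i 0 = 0
  /-- the next event is the infimum of the later times at which the triggering function, with the
  own prediction made from the latest own sample, is nonnegative (`⊤` if there is no such time) -/
  ev_succ : ∀ i k, ev i (k + 1) = sInf ((fun t : ℝ => (t : EReal)) '' {t : ℝ |
    ev i k < t ∧ t < T ∧
      0 ≤ S.trigger i (fun j => c i j t) (S.hold (x i) (ev i k) t) (x i t)
            (fun j => seen i j t) t})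
  /-- every time in `[0, T)` lies in an inter-event interval of every agent -/
  cover : ∀ (i : Fin N) (t : ℝ), 0 ≤ t → t < T → ∃ k, ev i k ≤ t ∧ t < ev i (k + 1)
  xt_eq : ∀ (i : Fin N) (k : ℕ) (t : ℝ), ev i k ≤ t → t < ev i (k + 1) → t < T →
    xt i t = S.hold (x i) (ev i k) t
  seen_eq : ∀ (i j : Fin N) (t : ℝ), 0 ≤ t → t < T →
    seen i j t = xt j t ∨ ∃ k, ev j (k + 1) = t ∧ seen i j t = S.hold (x j) (ev j k) t
  x_cont : ∀ i, ContinuousOn (x i) {t : ℝ | 0 ≤ t ∧ t < T}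
  c_cont : ∀ i j, ContinuousOn (c i j) {t : ℝ | 0 ≤ t ∧ t < T}
  /-- `ẋᵢ = A xᵢ + B uᵢ`, `uᵢ = K ∑ⱼ cᵢⱼ aᵢⱼ (x̃ᵢ - x̃ⱼ)`; the right derivative is used because the
  input jumps at event instants -/
  x_ode : ∀ (i : Fin N) (t : ℝ), 0 ≤ t → t < T →
    HasDerivWithinAt (x i)
      (S.A *ᵥ x i t + S.B *ᵥ (S.K *ᵥ ∑ j, (c i j t * S.a i j) • (xt i t - xt j t)))
      (Set.Ici t) t
  /-- `ċᵢⱼ = κᵢⱼ aᵢⱼ (-ϱᵢⱼ cᵢⱼ + (x̃ᵢ - x̃ⱼ)ᵀΓ(x̃ᵢ - x̃ⱼ))` -/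
  c_ode : ∀ (i j : Fin N) (t : ℝ), 0 ≤ t → t < T →
    HasDerivWithinAt (c i j)
      (S.κ i j * S.a i j *
        (-(S.ϱ i j * c i j t) + (xt i t - xt j t) ⬝ᵥ S.Γ *ᵥ (xt i t - xt j t)))
      (Set.Ici t) t

/-- The input magnitude `∑ⱼ aᵢⱼ ‖BK‖ ‖x̃ᵢ - x̃ⱼ‖` at time `t` (spectral and Euclidean norms). -/
def inputSize (S : ConsensusNetwork N n m) (xt : Fin N → ℝ → Fin n → ℝ) (i : Fin N) (t : ℝ) : ℝ :=
  ∑ j, S.a i j * ‖S.B * S.K‖ * ‖WithLp.toLp 2 (xt i t - xt j t)‖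

/-- The right-hand side of the implicit equation for the inter-event bound `τ` of agent `i` after an
event at time `s`:
`(1/‖A‖) ln (1 + (‖A‖ / (c̄ σ ‖K‖)) √(μ e^{-ν(s+τ)} / (dᵢ (1 + δ c̄))))`,
to be read as its limit `(1 / (c̄ σ ‖K‖)) √(μ e^{-ν(s+τ)} / (dᵢ (1 + δ c̄)))` if `A = 0`. -/
def tauRhs (S : ConsensusNetwork N n m) (i : Fin N) (cbar σ s τ : ℝ) : ℝ :=
  if S.A = 0 then
    1 / (cbar * σ * ‖S.K‖) *
      √(S.μ * Real.exp (-(S.ν * (s + τ))) / (S.deg i * (1 + S.δ * cbar)))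
  else
    1 / ‖S.A‖ * Real.log (1 + ‖S.A‖ / (cbar * σ * ‖S.K‖) *
      √(S.μ * Real.exp (-(S.ν * (s + τ))) / (S.deg i * (1 + S.δ * cbar))))

end ConsensusNetwork

end

/-! The engine is an energy `V`: the disagreement of all pairs of states measured by `P`, plus the
squared deviations of the edge weights from a free constant `α`. The Riccati equation turns the
drift into `-|xᵢ - xⱼ|²` plus a term in `‖K(xᵢ - xⱼ)‖²`. The adaptation law cancels the coupling
terms weighted by `cᵢⱼ` and leaves `-(N α / 4) ∑ aᵢⱼ ‖K(x̃ᵢ - x̃ⱼ)‖²`, so a large `α` absorbs every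
other term in the broadcast disagreement (`consensus_dissipation`, `exists_energy_dissipation`).
What remains is a multiple of the sampling errors `‖K eᵢ‖²` and a constant.

The weights may start negative, and while `1 + δ cᵢⱼ` is not bounded below by a positive number the
triggering rule does not control `‖K eᵢ‖²`. Two cases result. If `T = ∞`, the leakage damps the
negative parts exponentially (`le_weight`). After some time `1 + δ cᵢⱼ ≥ 1/2`, the rule controls the
errors, and `V` stays bounded; before that time compactness suffices. If `T < ∞`, each prediction is
at most a constant times an earlier state. The states are controlled by `V` and by the mean, which
follows `ẋ = A x` because the symmetric couplings cancel. Hence `V'` is bounded affinely by the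
running maximum of `V`, and comparison with an exponential bounds `V` on `[0, T)`.

A bounded `V` bounds the weights and, when `T < ∞`, the states and the inputs. The sampling error
vanishes at a sample and grows at most as Grönwall's inequality allows, whereas an event needs an
error of a size fixed by `μ e^{-νt}`. This separates events uniformly on a bounded life span; if `T
= ∞`, finiteness is already contained in the covering assumption. The explicit `τ` is a fixed point
given by the intermediate value theorem. -/

/-! ### Comparison for right derivatives -/

section Comparison

open Set Filter Topology

/-- A comparison principle: if the right derivative of `f` is smaller than that of `W` whenever `f`
touches `W` without having exceeded it before, then `f` stays below `W`. -/
theorem le_of_deriv_right_lt_of_running_le {f f' W W' : ℝ → ℝ} {a b : ℝ}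
    (hf : ContinuousOn f (Icc a b))
    (hf' : ∀ t ∈ Ico a b, HasDerivWithinAt f (f' t) (Ici t) t)
    (hW : ContinuousOn W (Icc a b))
    (hW' : ∀ t ∈ Ico a b, HasDerivWithinAt W (W' t) (Ici t) t)
    (h0 : f a ≤ W a)
    (hlt : ∀ t ∈ Ico a b, (∀ s ∈ Icc a t, f s ≤ W s) → f t = W t → f' t < W' t) :
    ∀ t ∈ Icc a b, f t ≤ W t := by
  set S : Set ℝ := {t | ∀ s ∈ Icc a t, f s ≤ W s} with hS
  have haS : a ∈ S := by
    intro s hs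
    rw [Icc_self, mem_singleton_iff] at hs
    rwa [hs]
  have hlow : ∀ t ∈ S, ∀ s ≤ t, s ∈ S := fun t ht s hst r hr => ht r ⟨hr.1, hr.2.trans hst⟩
  have hclosed : IsClosed (S ∩ Icc a b) := by
    have hcl : IsClosed {t ∈ Icc a b | f t ≤ W t} :=
      isClosed_Icc.isClosed_le hf hW
    refine isClosed_of_closure_subset fun t ht => ?_
    have htI : t ∈ Icc a b := closure_minimal inter_subset_right isClosed_Icc ht
    refine ⟨fun s hs => ?_, htI⟩
    rcases eq_or_lt_of_le hs.2 with rfl | hst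
    · have hsub : S ∩ Icc a b ⊆ {t ∈ Icc a b | f t ≤ W t} :=
        fun r hr => ⟨hr.2, hr.1 r ⟨hr.2.1, le_rfl⟩⟩
      exact (closure_minimal hsub hcl ht).2
    · obtain ⟨r, hr, hrS⟩ := mem_closure_iff_nhds.1 ht _ (Ioi_mem_nhds hst)
      exact hrS.1 s ⟨hs.1, le_of_lt hr⟩
  have hmain : Icc a b ⊆ S := by
    -- Continuous induction. If `f t < W t`, continuity gives room to the right; if the graphs
    -- touch, the slope of `W - f` at `t` is positive. Membership in `S` records the whole past,
    -- which `hlt` demands.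
    refine hclosed.Icc_subset_of_forall_exists_gt haS fun t ht y hy => ?_
    obtain ⟨htS, htI⟩ := ht
    have hev : ∀ᶠ s in 𝓝[>] t, f s ≤ W s := by
      rcases lt_or_eq_of_le (htS t ⟨htI.1, le_rfl⟩) with hlt' | heq
      · have hd : ContinuousWithinAt (fun s => W s - f s) (Ioi t) t :=
          (((hW' t htI).sub (hf' t htI)).continuousWithinAt).mono Ioi_subset_Ici_self
        have : ∀ᶠ s in 𝓝[>] t, 0 < W s - f s := hd.eventually (lt_mem_nhds (sub_pos.2 hlt'))
        filter_upwards [this] with s hs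
        linarith
      · have hd := (hW' t htI).sub (hf' t htI)
        have hpos : 0 < W' t - f' t := sub_pos.2 (hlt t htI htS heq)
        have hsl := (hasDerivWithinAt_iff_tendsto_slope' (notMem_Ioi.2 le_rfl)).1
          hd.Ioi_of_Ici
        filter_upwards [hsl.eventually (lt_mem_nhds hpos), self_mem_nhdsWithin] with s hs hts
        rw [slope_def_field] at hs
        have hts' : 0 < s - t := sub_pos.2 hts
        have := (div_pos_iff_of_pos_right hts').1 hs
        simp only [Pi.sub_apply] at this
        linarith
    obtain ⟨u, hu, hu'⟩ := mem_nhdsGT_iff_exists_Ioo_subset.1 hev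
    have hu0 : t < u := hu
    have hy0 : t < y := hy
    refine ⟨min y ((t + u) / 2), fun s hs => ?_, lt_min hy0 (by linarith), min_le_left _ _⟩
    rcases le_or_gt s t with hst | hst
    · exact htS s ⟨hs.1, hst⟩
    · exact hu' ⟨hst, (hs.2.trans (min_le_right _ _)).trans_lt (by linarith)⟩
  exact fun t ht => hmain ht t ⟨ht.1, le_rfl⟩

end Comparison

/-! ### Euclidean estimates for matrices and linear systems -/

section Matrices

open Set

variable {n m : ℕ}

theorem norm_toLp_mulVec_le (A : Matrix (Fin m) (Fin n) ℝ) (v : Fin n → ℝ) :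
    ‖WithLp.toLp 2 (A *ᵥ v)‖ ≤ ‖A‖ * ‖WithLp.toLp 2 v‖ :=
  Matrix.l2_opNorm_mulVec A (WithLp.toLp 2 v)

theorem HasDerivWithinAt.toLp_two {v : ℝ → Fin n → ℝ} {v' : Fin n → ℝ} {s : Set ℝ} {t : ℝ}
    (h : HasDerivWithinAt v v' s t) :
    HasDerivWithinAt (fun r => WithLp.toLp 2 (v r)) (WithLp.toLp 2 v') s t :=
  ((PiLp.continuousLinearEquiv 2 ℝ (fun _ : Fin n => ℝ)).symm.toContinuousLinearMap.hasFDerivAt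
    (x := v t)).comp_hasDerivWithinAt t h

theorem continuous_toLp_two : Continuous fun v : Fin n → ℝ => WithLp.toLp 2 v :=
  PiLp.continuous_toLp 2 _

/-- Grönwall's inequality for a perturbed linear system. -/
theorem norm_toLp_le_gronwallBound {A : Matrix (Fin n) (Fin n) ℝ} {v g : ℝ → Fin n → ℝ}
    {a b ε : ℝ} (hv : ContinuousOn v (Icc a b))
    (hv' : ∀ t ∈ Ico a b, HasDerivWithinAt v (A *ᵥ v t + g t) (Ici t) t)
    (hg : ∀ t ∈ Ico a b, ‖WithLp.toLp 2 (g t)‖ ≤ ε) :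
    ∀ t ∈ Icc a b, ‖WithLp.toLp 2 (v t)‖ ≤
      gronwallBound ‖WithLp.toLp 2 (v a)‖ ‖A‖ ε (t - a) := by
  refine norm_le_gronwallBound_of_norm_deriv_right_le
    (f := fun t => WithLp.toLp 2 (v t)) (f' := fun t => WithLp.toLp 2 (A *ᵥ v t + g t))
    (continuous_toLp_two.comp_continuousOn hv) (fun t ht => (hv' t ht).toLp_two) le_rfl ?_
  intro t ht
  rw [WithLp.toLp_add]
  exact (norm_add_le _ _).trans (add_le_add (norm_toLp_mulVec_le _ _) (hg t ht))

theorem HasDerivWithinAt.matrix_mulVec (M : Matrix (Fin m) (Fin n) ℝ) {v : ℝ → Fin n → ℝ}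
    {v' : Fin n → ℝ} {s : Set ℝ} {t : ℝ} (h : HasDerivWithinAt v v' s t) :
    HasDerivWithinAt (fun r => M *ᵥ v r) (M *ᵥ v') s t :=
  ((Matrix.mulVecLin M).toContinuousLinearMap.hasFDerivAt (x := v t)).comp_hasDerivWithinAt t h

theorem HasDerivWithinAt.dotProduct {v w : ℝ → Fin n → ℝ}
    {v' w' : Fin n → ℝ} {s : Set ℝ} {t : ℝ} (hv : HasDerivWithinAt v v' s t)
    (hw : HasDerivWithinAt w w' s t) :
    HasDerivWithinAt (fun r => v r ⬝ᵥ w r) (v' ⬝ᵥ w t + v t ⬝ᵥ w') s t := by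
  unfold _root_.dotProduct
  rw [← Finset.sum_add_distrib]
  exact HasDerivWithinAt.fun_sum fun i _ =>
    (hasDerivWithinAt_pi.1 hv i).mul (hasDerivWithinAt_pi.1 hw i)

theorem norm_toLp_sq (v : Fin n → ℝ) : ‖WithLp.toLp 2 v‖ ^ 2 = v ⬝ᵥ v := by
  rw [EuclideanSpace.norm_sq_eq]
  simp [dotProduct, sq]

theorem inner_toLp_eq (v w : Fin n → ℝ) :
    inner ℝ (WithLp.toLp 2 v) (WithLp.toLp 2 w) = v ⬝ᵥ w := by
  rw [EuclideanSpace.inner_toLp_toLp, star_trivial, dotProduct_comm]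

theorem dotProduct_mulVec_self_le (M : Matrix (Fin n) (Fin n) ℝ) (v : Fin n → ℝ) :
    v ⬝ᵥ M *ᵥ v ≤ ‖M‖ * ‖WithLp.toLp 2 v‖ ^ 2 := by
  rw [← inner_toLp_eq]
  refine (real_inner_le_norm _ _).trans ?_
  nlinarith [norm_toLp_mulVec_le M v, norm_nonneg (WithLp.toLp 2 v)]

open scoped MatrixOrder in
/-- A positive definite quadratic form dominates a multiple of the squared norm. -/
theorem Matrix.PosDef.exists_norm_sq_le {M : Matrix (Fin n) (Fin n) ℝ} (hM : M.PosDef) :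
    ∃ C : ℝ, 0 < C ∧ ∀ v : Fin n → ℝ, ‖WithLp.toLp 2 v‖ ^ 2 ≤ C * (v ⬝ᵥ M *ᵥ v) := by
  classical
  -- With `M = Rᴴ R` the form is `‖R v‖²`, and `v = R⁻¹ (R v)`.
  obtain ⟨R, hR, rfl⟩ : ∃ R : Matrix (Fin n) (Fin n) ℝ, IsUnit R ∧ M = Rᴴ * R :=
    (CStarAlgebra.isStrictlyPositive_iff_eq_star_mul_self.1
      hM.isStrictlyPositive)
  refine ⟨‖R⁻¹‖ ^ 2 + 1, by positivity, fun v => ?_⟩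
  have h1 : R⁻¹ *ᵥ (R *ᵥ v) = v := by
    rw [Matrix.mulVec_mulVec, Matrix.nonsing_inv_mul _ ((Matrix.isUnit_iff_isUnit_det _).1 hR),
      Matrix.one_mulVec]
  have h2 : v ⬝ᵥ (Rᴴ * R) *ᵥ v = ‖WithLp.toLp 2 (R *ᵥ v)‖ ^ 2 := by
    rw [norm_toLp_sq, ← Matrix.mulVec_mulVec, Matrix.conjTranspose_eq_transpose_of_trivial,
      Matrix.dotProduct_mulVec, Matrix.vecMul_transpose]
  have h3 := norm_toLp_mulVec_le R⁻¹ (R *ᵥ v)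
  rw [h1] at h3
  rw [h2]
  have h4 : ‖WithLp.toLp 2 v‖ ^ 2 ≤ (‖R⁻¹‖ * ‖WithLp.toLp 2 (R *ᵥ v)‖) ^ 2 := by gcongr
  nlinarith [sq_nonneg ‖WithLp.toLp 2 (R *ᵥ v)‖]

end Matrices

/-! ### Couplings and dissipation on an undirected graph -/

section Coupling

variable {ι F : Type*} [Fintype ι] [NormedAddCommGroup F]

theorem norm_sub_sq_le_two_mul (u v w : F) :
    ‖u - w‖ ^ 2 ≤ 2 * ‖u - v‖ ^ 2 + 2 * ‖v - w‖ ^ 2 := by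
  have h : ‖u - w‖ ≤ ‖u - v‖ + ‖v - w‖ := norm_sub_le_norm_sub_add_norm_sub u v w
  nlinarith [norm_nonneg (u - w), sq_nonneg (‖u - v‖ - ‖v - w‖)]

variable (F) in
/-- On a connected graph the disagreement of all pairs is controlled by that along the edges. -/
theorem SimpleGraph.Connected.exists_sum_norm_sub_sq_le {G : SimpleGraph ι} (hG : G.Connected)
    {a : ι → ι → ℝ} (ha : ∀ i j, 0 ≤ a i j) (hadj : ∀ i j, G.Adj i j → a i j = 1) :
    ∃ C : ℝ, 0 ≤ C ∧ ∀ y : ι → F,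
      ∑ i, ∑ j, ‖y i - y j‖ ^ 2 ≤ C * ∑ i, ∑ j, a i j * ‖y i - y j‖ ^ 2 := by
  have hE : ∀ (y : ι → F) i j, a i j * ‖y i - y j‖ ^ 2 ≤
      ∑ i, ∑ j, a i j * ‖y i - y j‖ ^ 2 := fun y i j => by
    have hnn : ∀ i j, 0 ≤ a i j * ‖y i - y j‖ ^ 2 := fun i j => mul_nonneg (ha i j) (sq_nonneg _)
    exact (Finset.single_le_sum (f := fun j => a i j * ‖y i - y j‖ ^ 2)
      (fun j _ => hnn i j) (Finset.mem_univ j)).trans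
      (Finset.single_le_sum (f := fun i => ∑ j, a i j * ‖y i - y j‖ ^ 2)
        (fun i _ => Finset.sum_nonneg fun j _ => hnn i j) (Finset.mem_univ i))
  have hpair : ∀ i j, ∃ C : ℝ, 0 ≤ C ∧ ∀ y : ι → F,
      ‖y i - y j‖ ^ 2 ≤ C * ∑ i, ∑ j, a i j * ‖y i - y j‖ ^ 2 := by
    intro i j
    obtain ⟨p⟩ := hG.preconnected i j
    -- Along a walk each further edge costs one use of `‖u - w‖² ≤ 2‖u - v‖² + 2‖v - w‖²`, so the
    -- constant depends on the walk only and not on `y`.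
    induction p with
    | nil => exact ⟨0, le_rfl, fun y => by simp⟩
    | @cons u v w huv p ih =>
      obtain ⟨C, hC, h⟩ := ih
      refine ⟨2 + 2 * C, by positivity, fun y => ?_⟩
      have h1 := hE y u v
      rw [hadj u v huv, one_mul] at h1
      have h2 := norm_sub_sq_le_two_mul (y u) (y v) (y w)
      linarith [h y]
  choose C hC h using hpair
  refine ⟨∑ i, ∑ j, C i j, Finset.sum_nonneg fun i _ => Finset.sum_nonneg fun j _ => hC i j,
    fun y => ?_⟩
  simp_rw [Finset.sum_mul]
  exact Finset.sum_le_sum fun i _ => Finset.sum_le_sum fun j _ => h i j y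

/-- The triangle inequality through `η i` and `η j` produces the errors of both endpoints with
factor 3; by symmetry of `a` they are merged into the error of the first endpoint. This passes from
true states to broadcast predictions. -/
theorem sum_edge_norm_sub_sq_le {a : ι → ι → ℝ} {y η : ι → F}
    (ha : ∀ i j, 0 ≤ a i j) (hsymm : ∀ i j, a i j = a j i) :
    ∑ i, ∑ j, a i j * ‖y i - y j‖ ^ 2 ≤
      ∑ i, ∑ j, a i j * (3 * ‖η i - η j‖ ^ 2 + 6 * ‖η i - y i‖ ^ 2) := by
  have h1 : ∑ i, ∑ j, a i j * (3 * ‖η i - η j‖ ^ 2 + 6 * ‖η i - y i‖ ^ 2) =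
      ∑ i, ∑ j, a i j * (3 * ‖η i - η j‖ ^ 2 + 3 * ‖η i - y i‖ ^ 2 + 3 * ‖η j - y j‖ ^ 2) := by
    have h2 : ∑ i, ∑ j, a i j * (3 * ‖η i - y i‖ ^ 2) =
        ∑ i, ∑ j, a i j * (3 * ‖η j - y j‖ ^ 2) := by
      rw [Finset.sum_comm]
      exact Finset.sum_congr rfl fun i _ => Finset.sum_congr rfl fun j _ => by rw [hsymm j i]
    have h3 : ∀ i j, a i j * (3 * ‖η i - η j‖ ^ 2 + 6 * ‖η i - y i‖ ^ 2) =
        a i j * (3 * ‖η i - η j‖ ^ 2) + a i j * (3 * ‖η i - y i‖ ^ 2)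
          + a i j * (3 * ‖η i - y i‖ ^ 2) := fun i j => by ring
    simp_rw [h3, mul_add, Finset.sum_add_distrib]
    rw [h2]
  rw [h1]
  refine Finset.sum_le_sum fun i _ => Finset.sum_le_sum fun j _ =>
    mul_le_mul_of_nonneg_left ?_ (ha i j)
  have e : y i - y j = (η i - η j) + -(η i - y i) + (η j - y j) := by abel
  have h : ‖y i - y j‖ ≤ ‖η i - η j‖ + ‖η i - y i‖ + ‖η j - y j‖ := by
    rw [e]
    refine (norm_add₃_le).trans ?_
    rw [norm_neg]
  have h0 := norm_nonneg (y i - y j)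
  set p := ‖η i - η j‖
  set q := ‖η i - y i‖
  set r := ‖η j - y j‖
  nlinarith [sq_nonneg (p - q), sq_nonneg (p - r), sq_nonneg (q - r)]

/-- The couplings on an undirected weighted graph sum to zero. -/
theorem sum_coupling_eq_zero {E : Type*} [AddCommGroup E] [Module ℝ E] {b : ι → ι → ℝ}
    (hb : ∀ i j, b i j = b j i) (η : ι → E) :
    ∑ i, ∑ j, b i j • (η i - η j) = 0 := by
  have h : ∑ i, ∑ j, b i j • (η i - η j) = -∑ i, ∑ j, b i j • (η i - η j) := by
    conv_lhs => rw [Finset.sum_comm]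
    rw [← Finset.sum_neg_distrib]
    refine Finset.sum_congr rfl fun i _ => ?_
    rw [← Finset.sum_neg_distrib]
    refine Finset.sum_congr rfl fun j _ => ?_
    rw [hb j i, ← smul_neg, neg_sub]
  have h2 : (2 : ℝ) • ∑ i, ∑ j, b i j • (η i - η j) = 0 := by
    rw [two_smul]
    nth_rw 1 [h]
    exact neg_add_cancel _
  exact (smul_eq_zero.1 h2).resolve_left two_ne_zero

variable [InnerProductSpace ℝ F]

/-- The cross terms vanish because the `w i` sum to zero. The resulting factor `card ι` is the
reason for the weight `N` on the adaptation part of the energy. -/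
theorem sum_inner_sub_sub_eq (y w : ι → F) (hw : ∑ i, w i = 0) :
    ∑ i, ∑ j, inner ℝ (y i - y j) (w i - w j) =
      2 * (Fintype.card ι : ℝ) * ∑ i, inner ℝ (y i) (w i) := by
  have h1 : ∀ i j, inner ℝ (y i - y j) (w i - w j) =
      (inner ℝ (y i) (w i) + inner ℝ (y j) (w j)) - inner ℝ (y i) (w j) - inner ℝ (y j) (w i) :=
    fun i j => by simp only [inner_sub_left, inner_sub_right]; ring
  simp_rw [h1, Finset.sum_sub_distrib, Finset.sum_add_distrib]
  have h2 : ∑ i, ∑ j, inner ℝ (y i) (w j) = 0 := by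
    simp_rw [← inner_sum, hw, inner_zero_right, Finset.sum_const_zero]
  have h3 : ∑ i, ∑ j, inner ℝ (y j) (w i) = 0 := by
    rw [Finset.sum_comm]; exact h2
  rw [h2, h3]
  simp only [Finset.sum_const, Finset.card_univ, nsmul_eq_mul, ← Finset.mul_sum]
  ring

/-- Swapping `i` and `j` and averaging replaces `η i` by half of `η i - η j`. -/
theorem sum_inner_coupling_eq {b : ι → ι → ℝ} (hb : ∀ i j, b i j = b j i) (η : ι → F) :
    ∑ i, ∑ j, b i j * inner ℝ (η i) (η i - η j) = 1 / 2 * ∑ i, ∑ j, b i j * ‖η i - η j‖ ^ 2 := by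
  have h1 : ∑ i, ∑ j, b i j * inner ℝ (η i) (η i - η j) =
      ∑ i, ∑ j, -(b i j * inner ℝ (η j) (η i - η j)) := by
    rw [Finset.sum_comm]
    refine Finset.sum_congr rfl fun i _ => Finset.sum_congr rfl fun j _ => ?_
    rw [hb j i, ← neg_sub (η i) (η j), inner_neg_right, mul_neg]
  have h2 : ∑ i, ∑ j, b i j * ‖η i - η j‖ ^ 2 =
      ∑ i, ∑ j, b i j * inner ℝ (η i) (η i - η j) +
        ∑ i, ∑ j, -(b i j * inner ℝ (η j) (η i - η j)) := by
    rw [← Finset.sum_add_distrib]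
    refine Finset.sum_congr rfl fun i _ => ?_
    rw [← Finset.sum_add_distrib]
    refine Finset.sum_congr rfl fun j _ => ?_
    rw [← real_inner_self_eq_norm_sq]
    nth_rw 1 [inner_sub_left]
    ring
  rw [h2, ← h1]
  ring

/-- Dissipation of a sampled adaptive coupling whose sampling errors obey the triggering rule. -/
theorem neg_sum_inner_coupling_le {a c : ι → ι → ℝ} {C₀ δ μ : ℝ} {y η : ι → F}
    (ha : ∀ i j, 0 ≤ a i j) (hb : ∀ i j, c i j * a i j = c j i * a j i)
    (hc : ∀ i j, a i j ≠ 0 → -C₀ ≤ c i j) (hC₀ : 0 ≤ C₀) (hδ : 0 < δ)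
    (htrig : ∀ i, ∑ j, (1 + δ * c i j) * a i j * ‖η i - y i‖ ^ 2
      ≤ 1 / 4 * ∑ j, a i j * ‖η i - η j‖ ^ 2 + μ) :
    -∑ i, inner ℝ (y i) (∑ j, (c i j * a i j) • (η i - η j)) ≤
      ∑ i, ∑ j, a i j * ((-(1 / 4) * c i j + C₀ / 2 + 1 / (4 * δ)) * ‖η i - η j‖ ^ 2
        + 2 * C₀ * ‖η i - y i‖ ^ 2) + Fintype.card ι * μ / δ := by
  have h1 : -∑ i, inner ℝ (y i) (∑ j, (c i j * a i j) • (η i - η j)) =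
      ∑ i, ∑ j, (c i j * a i j * inner ℝ (η i - y i) (η i - η j)
        - 1 / 2 * (c i j * a i j * ‖η i - η j‖ ^ 2)) := by
    have h2 := sum_inner_coupling_eq hb η
    simp_rw [inner_sum, real_inner_smul_right, inner_sub_left (𝕜 := ℝ) (η _) (y _),
      Finset.sum_sub_distrib, mul_sub, Finset.sum_sub_distrib, h2, Finset.mul_sum]
    ring
  have h3 : ∀ i j, c i j * a i j * inner ℝ (η i - y i) (η i - η j)
        - 1 / 2 * (c i j * a i j * ‖η i - η j‖ ^ 2) ≤
      a i j * ((-(1 / 4) * c i j + C₀ / 2) * ‖η i - η j‖ ^ 2 + 2 * C₀ * ‖η i - y i‖ ^ 2)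
        + c i j * a i j * ‖η i - y i‖ ^ 2 := by
    intro i j
    rcases (ha i j).eq_or_lt with h0 | h0
    · simp [← h0]
    have hcij := hc i j h0.ne'
    have hin := abs_le.1 (abs_real_inner_le_norm (η i - y i) (η i - η j))
    set r := inner ℝ (η i - y i) (η i - η j)
    set p := ‖η i - y i‖
    set q := ‖η i - η j‖
    -- Young's inequality `±r ≤ p² + q²/4`. As `c i j` may be negative, it is split as `(c i j + C₀)
    -- - C₀`, and each nonnegative coefficient uses one sign.
    have hr1 : 0 ≤ p ^ 2 + 1 / 4 * q ^ 2 - r := by nlinarith [sq_nonneg (p - q / 2)]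
    have hr2 : 0 ≤ p ^ 2 + 1 / 4 * q ^ 2 + r := by nlinarith [sq_nonneg (p - q / 2)]
    have e1 : 0 ≤ (c i j + C₀) * (p ^ 2 + 1 / 4 * q ^ 2 - r) := mul_nonneg (by linarith) hr1
    have e2 : 0 ≤ C₀ * (p ^ 2 + 1 / 4 * q ^ 2 + r) := mul_nonneg hC₀ hr2
    have key : 0 ≤ a i j * ((c i j + C₀) * (p ^ 2 + 1 / 4 * q ^ 2 - r)
        + C₀ * (p ^ 2 + 1 / 4 * q ^ 2 + r)) := mul_nonneg h0.le (by linarith)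
    nlinarith [key]
  have h4 : ∀ i, ∑ j, c i j * a i j * ‖η i - y i‖ ^ 2 ≤
      ∑ j, a i j * (1 / (4 * δ)) * ‖η i - η j‖ ^ 2 + μ / δ := by
    intro i
    -- Since `δ c ≤ 1 + δ c` for either sign of `c`, the triggering rule controls the errors
    -- weighted by `c i j`.
    have h5 : δ * ∑ j, c i j * a i j * ‖η i - y i‖ ^ 2 ≤
        ∑ j, (1 + δ * c i j) * a i j * ‖η i - y i‖ ^ 2 := by
      rw [Finset.mul_sum]
      refine Finset.sum_le_sum fun j _ => ?_
      nlinarith [mul_nonneg (ha i j) (sq_nonneg ‖η i - y i‖)]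
    have h6 : ∑ j, a i j * (1 / (4 * δ)) * ‖η i - η j‖ ^ 2 + μ / δ =
        (1 / 4 * ∑ j, a i j * ‖η i - η j‖ ^ 2 + μ) / δ := by
      rw [add_div, Finset.mul_sum, Finset.sum_div]
      congr 1
      refine Finset.sum_congr rfl fun j _ => ?_
      field_simp
    rw [h6, le_div_iff₀ hδ]
    linarith [htrig i]
  rw [h1]
  calc _ ≤ ∑ i, ∑ j, (a i j * ((-(1 / 4) * c i j + C₀ / 2) * ‖η i - η j‖ ^ 2
            + 2 * C₀ * ‖η i - y i‖ ^ 2) + c i j * a i j * ‖η i - y i‖ ^ 2) :=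
        Finset.sum_le_sum fun i _ => Finset.sum_le_sum fun j _ => h3 i j
    _ = ∑ i, (∑ j, a i j * ((-(1 / 4) * c i j + C₀ / 2) * ‖η i - η j‖ ^ 2
            + 2 * C₀ * ‖η i - y i‖ ^ 2) + ∑ j, c i j * a i j * ‖η i - y i‖ ^ 2) := by
        simp_rw [Finset.sum_add_distrib]
    _ ≤ ∑ i, (∑ j, a i j * ((-(1 / 4) * c i j + C₀ / 2) * ‖η i - η j‖ ^ 2
            + 2 * C₀ * ‖η i - y i‖ ^ 2) +
            (∑ j, a i j * (1 / (4 * δ)) * ‖η i - η j‖ ^ 2 + μ / δ)) :=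
        Finset.sum_le_sum fun i _ => by linarith [h4 i]
    _ = _ := by
        have hN : (Fintype.card ι : ℝ) * μ / δ = ∑ _i : ι, μ / δ := by
          rw [Finset.sum_const, Finset.card_univ, nsmul_eq_mul, mul_div_assoc]
        rw [hN, ← Finset.sum_add_distrib]
        refine Finset.sum_congr rfl fun i _ => ?_
        rw [← add_assoc, ← Finset.sum_add_distrib]
        congr 1
        refine Finset.sum_congr rfl fun j _ => ?_
        ring

/-- The dissipation inequality of the adaptive consensus energy. -/
theorem consensus_dissipation {a c ϱ : ι → ι → ℝ} {C₀ δ μ α G : ℝ} {y η : ι → F}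
    (ha : ∀ i j, 0 ≤ a i j) (hsymm : ∀ i j, a i j = a j i)
    (hb : ∀ i j, c i j * a i j = c j i * a j i)
    (hc : ∀ i j, a i j ≠ 0 → -C₀ ≤ c i j) (hC₀ : 0 ≤ C₀) (hδ : 0 < δ)
    (htrig : ∀ i, ∑ j, (1 + δ * c i j) * a i j * ‖η i - y i‖ ^ 2
      ≤ 1 / 4 * ∑ j, a i j * ‖η i - η j‖ ^ 2 + μ)
    (hG₀ : 0 ≤ G)
    (hG : ∑ i, ∑ j, ‖y i - y j‖ ^ 2 ≤ G * ∑ i, ∑ j, a i j * ‖y i - y j‖ ^ 2) :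
    -(1 / 2 * ∑ i, ∑ j, inner ℝ (y i - y j)
        (∑ l, (c i l * a i l) • (η i - η l) - ∑ l, (c j l * a j l) • (η j - η l)))
      + 1 / 4 * ∑ i, ∑ j, ‖y i - y j‖ ^ 2
      + Fintype.card ι * ∑ i, ∑ j, a i j *
          (1 / 4 * (c i j - α) * (-(ϱ i j * c i j) + ‖η i - η j‖ ^ 2)) ≤
    -(Fintype.card ι / 4 * ∑ i, ∑ j, a i j * (ϱ i j * (c i j - α) * c i j))
      + ∑ i, ∑ j, a i j *
        ((Fintype.card ι * (C₀ / 2 + 1 / (4 * δ)) + 3 / 4 * G - Fintype.card ι * α / 4) *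
            ‖η i - η j‖ ^ 2
          + (2 * Fintype.card ι * C₀ + 3 / 2 * G) * ‖η i - y i‖ ^ 2)
      + (Fintype.card ι : ℝ) ^ 2 * μ / δ := by
  have h1 := sum_inner_sub_sub_eq y (fun i => ∑ l, (c i l * a i l) • (η i - η l))
    (sum_coupling_eq_zero hb η)
  have h2 := neg_sum_inner_coupling_le ha hb hc hC₀ hδ htrig
  have h3 := sum_edge_norm_sub_sq_le (y := y) (η := η) ha hsymm
  have h4 := hG.trans (mul_le_mul_of_nonneg_left h3 hG₀)
  set M : ℝ := (Fintype.card ι : ℝ) with hM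
  have hM0 : 0 ≤ M := by positivity
  have h5 := mul_le_mul_of_nonneg_left h2 hM0
  rw [h1]
  -- The terms `∓(M/4) c i j ‖η i - η j‖²` of coupling and adaptation cancel here, leaving `-(M α/4)
  -- ‖η i - η j‖²`.
  have h6 : M * ∑ i, ∑ j, a i j *
          (1 / 4 * (c i j - α) * (-(ϱ i j * c i j) + ‖η i - η j‖ ^ 2)) +
      M * ∑ i, ∑ j, a i j * ((-(1 / 4) * c i j + C₀ / 2 + 1 / (4 * δ)) * ‖η i - η j‖ ^ 2
        + 2 * C₀ * ‖η i - y i‖ ^ 2) +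
      1 / 4 * (G * ∑ i, ∑ j, a i j * (3 * ‖η i - η j‖ ^ 2 + 6 * ‖η i - y i‖ ^ 2)) =
    -(M / 4 * ∑ i, ∑ j, a i j * (ϱ i j * (c i j - α) * c i j))
      + ∑ i, ∑ j, a i j *
        ((M * (C₀ / 2 + 1 / (4 * δ)) + 3 / 4 * G - M * α / 4) * ‖η i - η j‖ ^ 2
          + (2 * M * C₀ + 3 / 2 * G) * ‖η i - y i‖ ^ 2) := by
    simp_rw [Finset.mul_sum, ← Finset.sum_neg_distrib, ← Finset.sum_add_distrib]
    refine Finset.sum_congr rfl fun i _ => Finset.sum_congr rfl fun j _ => ?_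
    ring
  have h7 : M * (M * μ / δ) = M ^ 2 * μ / δ := by ring
  nlinarith [h5, h6, h7, h4]

end Coupling

/-! ### Feedback gain and Riccati identities -/

namespace ConsensusNetwork

open Set Filter Topology

variable {N n m : ℕ} {S : ConsensusNetwork N n m}

theorem a_nonneg (S : ConsensusNetwork N n m) (i j : Fin N) : 0 ≤ S.a i j := by
  unfold a; split_ifs <;> norm_num

theorem a_of_adj {i j : Fin N} (hij : S.G.Adj i j) : S.a i j = 1 := by
  unfold a; exact if_pos hij

theorem a_of_not_adj {i j : Fin N} (hij : ¬S.G.Adj i j) : S.a i j = 0 := by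
  unfold a; exact if_neg hij

theorem adj_of_a_ne_zero {i j : Fin N} (hij : S.a i j ≠ 0) : S.G.Adj i j := by
  by_contra hn
  exact hij (a_of_not_adj hn)

theorem a_symm (S : ConsensusNetwork N n m) (i j : Fin N) : S.a i j = S.a j i := by
  by_cases hij : S.G.Adj i j
  · rw [a_of_adj hij, a_of_adj hij.symm]
  · rw [a_of_not_adj hij, a_of_not_adj fun hji => hij hji.symm]

/-- The vector `K v`, with the Euclidean norm. -/
def gain (S : ConsensusNetwork N n m) (v : Fin n → ℝ) : EuclideanSpace ℝ (Fin m) :=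
  WithLp.toLp 2 (S.K *ᵥ v)

theorem gain_sub (S : ConsensusNetwork N n m) (v w : Fin n → ℝ) :
    S.gain (v - w) = S.gain v - S.gain w := by
  simp [gain, Matrix.mulVec_sub]

theorem gain_sum_smul (S : ConsensusNetwork N n m) {ι : Type*} (s : Finset ι) (b : ι → ℝ)
    (v : ι → Fin n → ℝ) : S.gain (∑ j ∈ s, b j • v j) = ∑ j ∈ s, b j • S.gain (v j) := by
  simp [gain, Matrix.mulVec_sum, Matrix.mulVec_smul, WithLp.toLp_sum]

theorem continuous_gain (S : ConsensusNetwork N n m) : Continuous S.gain :=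
  continuous_toLp_two.comp (Continuous.matrix_mulVec continuous_const continuous_id)

theorem norm_gain_le (S : ConsensusNetwork N n m) (v : Fin n → ℝ) :
    ‖S.gain v‖ ≤ ‖S.K‖ * ‖WithLp.toLp 2 v‖ := norm_toLp_mulVec_le _ _

namespace IsDesigned

theorem P_transpose (hS : S.IsDesigned) : S.Pᵀ = S.P := by
  have h := hS.posDef.isHermitian
  rwa [Matrix.IsHermitian, Matrix.conjTranspose_eq_transpose_of_trivial] at h

theorem Γ_eq (hS : S.IsDesigned) : S.Γ = S.Kᵀ * S.K := by
  simp only [Γ, K, Matrix.transpose_neg, Matrix.transpose_mul, Matrix.transpose_transpose,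
    hS.P_transpose, Matrix.neg_mul, Matrix.mul_neg, neg_neg, Matrix.mul_assoc]

theorem dotProduct_Γ_mulVec (hS : S.IsDesigned) (v w : Fin n → ℝ) :
    v ⬝ᵥ S.Γ *ᵥ w = inner ℝ (S.gain v) (S.gain w) := by
  rw [gain, gain, inner_toLp_eq, hS.Γ_eq, ← Matrix.mulVec_mulVec, Matrix.dotProduct_mulVec,
    Matrix.vecMul_transpose]

theorem dotProduct_Γ_mulVec_self (hS : S.IsDesigned) (v : Fin n → ℝ) :
    v ⬝ᵥ S.Γ *ᵥ v = ‖S.gain v‖ ^ 2 := by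
  rw [hS.dotProduct_Γ_mulVec, real_inner_self_eq_norm_sq]

theorem dotProduct_P_mulVec_comm (hS : S.IsDesigned) (v w : Fin n → ℝ) :
    v ⬝ᵥ S.P *ᵥ w = w ⬝ᵥ S.P *ᵥ v := by
  rw [Matrix.dotProduct_mulVec, ← Matrix.mulVec_transpose, hS.P_transpose, dotProduct_comm]

theorem dotProduct_PB_mulVec (hS : S.IsDesigned) (v w : Fin n → ℝ) :
    v ⬝ᵥ S.P *ᵥ (S.B *ᵥ (S.K *ᵥ w)) = -inner ℝ (S.gain v) (S.gain w) := by
  rw [← hS.dotProduct_Γ_mulVec]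
  simp only [Γ, K, Matrix.mulVec_mulVec, Matrix.neg_mulVec, Matrix.mulVec_neg,
    dotProduct_neg, Matrix.mul_assoc]

/-- Half of the Riccati equation read as a quadratic form: the forms of `PA` and `AᵀP` agree. -/
theorem dotProduct_PA_mulVec_self (hS : S.IsDesigned) (v : Fin n → ℝ) :
    v ⬝ᵥ S.P *ᵥ (S.A *ᵥ v) = 1 / 2 * ‖S.gain v‖ ^ 2 - 1 / 2 * (v ⬝ᵥ v) := by
  have h1 := congrArg (fun M => v ⬝ᵥ M *ᵥ v) hS.riccati
  have h2 : v ⬝ᵥ (S.Aᵀ * S.P) *ᵥ v = v ⬝ᵥ S.P *ᵥ (S.A *ᵥ v) := by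
    rw [← Matrix.mulVec_mulVec, Matrix.dotProduct_mulVec, Matrix.vecMul_transpose,
      hS.dotProduct_P_mulVec_comm]
  have h3 := hS.dotProduct_Γ_mulVec_self v
  simp only [Matrix.add_mulVec, Matrix.sub_mulVec, dotProduct_add, dotProduct_sub,
    Matrix.one_mulVec, Matrix.zero_mulVec, dotProduct_zero] at h1
  simp only [Γ, ← Matrix.mulVec_mulVec] at h1 h2 h3
  linarith

theorem trigger_eq (hS : S.IsDesigned) (i : Fin N) (w : Fin N → ℝ) (p y : Fin n → ℝ)
    (q : Fin N → Fin n → ℝ) (t : ℝ) :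
    S.trigger i w p y q t =
      ∑ j, (1 + S.δ * w j) * S.a i j * ‖S.gain (p - y)‖ ^ 2
        - 1 / 4 * ∑ j, S.a i j * ‖S.gain (p - q j)‖ ^ 2 - S.μ * Real.exp (-(S.ν * t)) := by
  simp only [trigger, hS.dotProduct_Γ_mulVec_self]

end IsDesigned

theorem hasDerivAt_hold (S : ConsensusNetwork N n m) (x : ℝ → Fin n → ℝ) (s : EReal) (t : ℝ) :
    HasDerivAt (S.hold x s) (S.A *ᵥ S.hold x s t) t := by
  have h1 : HasDerivAt (fun r : ℝ => NormedSpace.exp ((r - s.toReal) • S.A))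
      (S.A * NormedSpace.exp ((t - s.toReal) • S.A)) t := by
    have := (hasDerivAt_exp_smul_const' (𝕂 := ℝ) S.A (t - s.toReal)).scomp t
      ((hasDerivAt_id t).sub_const s.toReal)
    rw [one_smul] at this
    exact this
  let L : Matrix (Fin n) (Fin n) ℝ →L[ℝ] (Fin n → ℝ) :=
    (((Matrix.mulVecBilin ℝ ℝ).flip (x s.toReal) :
      Matrix (Fin n) (Fin n) ℝ →ₗ[ℝ] (Fin n → ℝ))).toContinuousLinearMap
  have h2 := (L.hasFDerivAt (x := NormedSpace.exp ((t - s.toReal) • S.A))).comp_hasDerivAt t h1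
  have h3 : L (S.A * NormedSpace.exp ((t - s.toReal) • S.A)) = S.A *ᵥ S.hold x s t := by
    simp [L, hold, Matrix.mulVec_mulVec]
  rw [h3] at h2
  exact h2

theorem continuous_hold (S : ConsensusNetwork N n m) (x : ℝ → Fin n → ℝ) (s : EReal) :
    Continuous (S.hold x s) :=
  continuous_iff_continuousAt.2 fun t => (S.hasDerivAt_hold x s t).continuousAt

theorem hold_self (S : ConsensusNetwork N n m) (x : ℝ → Fin n → ℝ) (s : ℝ) :
    S.hold x s s = x s := by
  simp [hold]

theorem norm_hold_le (S : ConsensusNetwork N n m) (x : ℝ → Fin n → ℝ) {s t : ℝ} (hst : s ≤ t) :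
    ‖WithLp.toLp 2 (S.hold x s t)‖ ≤ ‖WithLp.toLp 2 (x s)‖ * Real.exp (‖S.A‖ * (t - s)) := by
  have h := norm_toLp_le_gronwallBound (A := S.A) (v := S.hold x s) (g := fun _ => 0)
    (a := s) (b := t) (ε := 0) (S.continuous_hold x s).continuousOn
    (fun r _ => by simpa using (S.hasDerivAt_hold x s r).hasDerivWithinAt) (by simp)
    t ⟨hst, le_rfl⟩
  rwa [hold_self, gronwallBound_ε0] at h

/-! ### Event instants and sampling errors -/

namespace IsExecution

variable {T : EReal} {x : Fin N → ℝ → Fin n → ℝ} {c : Fin N → Fin N → ℝ → ℝ}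
  {ev : Fin N → ℕ → EReal} {xt : Fin N → ℝ → Fin n → ℝ} {seen : Fin N → Fin N → ℝ → Fin n → ℝ}

theorem ev_le_succ (h : S.IsExecution T x c ev xt seen) (i : Fin N) (k : ℕ) :
    ev i k ≤ ev i (k + 1) := by
  rw [h.ev_succ]
  refine le_sInf ?_
  rintro _ ⟨t, ht, rfl⟩
  exact ht.1.le

theorem ev_mono (h : S.IsExecution T x c ev xt seen) (i : Fin N) : Monotone (ev i) :=
  monotone_nat_of_le_succ (h.ev_le_succ i)

theorem ev_nonneg (h : S.IsExecution T x c ev xt seen) (i : Fin N) (k : ℕ) : 0 ≤ ev i k := by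
  rw [← h.ev_zero i]
  exact h.ev_mono i k.zero_le

theorem ev_lt_of_ne_top (h : S.IsExecution T x c ev xt seen) (i : Fin N) (k : ℕ)
    (hk : ev i k ≠ ⊤) : ev i k < T := by
  cases k with
  | zero => rw [h.ev_zero]; exact h.T_pos
  | succ k =>
    rw [h.ev_succ] at hk ⊢
    rcases eq_empty_or_nonempty ((fun t : ℝ => (t : EReal)) '' {t : ℝ | ev i k < t ∧ t < T ∧
      0 ≤ S.trigger i (fun j => c i j t) (S.hold (x i) (ev i k) t) (x i t)
            (fun j => seen i j t) t}) with he | ⟨_, t, ht, rfl⟩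
    · rw [he, sInf_empty] at hk
      exact absurd rfl hk
    · exact (sInf_le (mem_image_of_mem _ ht)).trans_lt ht.2.1

theorem exists_ev_eq_coe (h : S.IsExecution T x c ev xt seen) (i : Fin N) (k : ℕ)
    (hk : ev i k ≠ ⊤) : ∃ s : ℝ, 0 ≤ s ∧ (s : EReal) < T ∧ ev i k = s := by
  have h0 := h.ev_nonneg i k
  have hb : ev i k ≠ ⊥ := fun hb => by rw [hb] at h0; exact absurd h0 (by simp)
  have hc := EReal.coe_toReal hk hb
  refine ⟨(ev i k).toReal, ?_, ?_, hc.symm⟩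
  · exact EReal.toReal_nonneg h0
  · rw [hc]; exact h.ev_lt_of_ne_top i k hk

theorem exists_cover (h : S.IsExecution T x c ev xt seen) (i : Fin N) {t : ℝ} (h0 : 0 ≤ t)
    (ht : (t : EReal) < T) :
    ∃ (k : ℕ) (s : ℝ), ev i k = s ∧ 0 ≤ s ∧ s ≤ t ∧ (t : EReal) < ev i (k + 1) := by
  obtain ⟨k, hk, hk'⟩ := h.cover i t h0 ht
  obtain ⟨s, hs0, -, hs⟩ := h.exists_ev_eq_coe i k (hk.trans_lt (EReal.coe_lt_top t)).ne
  refine ⟨k, s, hs, hs0, ?_, hk'⟩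
  rw [hs] at hk
  exact EReal.coe_le_coe_iff.1 hk

theorem x_continuousWithinAt (h : S.IsExecution T x c ev xt seen) (i : Fin N) {t : ℝ}
    (h0 : 0 ≤ t) (ht : (t : EReal) < T) : ContinuousWithinAt (x i) (Ici t) t :=
  (h.x_ode i t h0 ht).continuousWithinAt

theorem c_continuousWithinAt (h : S.IsExecution T x c ev xt seen) (i j : Fin N) {t : ℝ}
    (h0 : 0 ≤ t) (ht : (t : EReal) < T) : ContinuousWithinAt (c i j) (Ici t) t :=
  (h.c_ode i j t h0 ht).continuousWithinAt

theorem Icc_subset {T : EReal} {a b : ℝ} (ha : 0 ≤ a) (hb : (b : EReal) < T) :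
    Icc a b ⊆ {t : ℝ | 0 ≤ t ∧ (t : EReal) < T} := fun _ ht =>
  ⟨ha.trans ht.1, (EReal.coe_le_coe_iff.2 ht.2).trans_lt hb⟩

theorem eventually_lt_coe {t : ℝ} {s : EReal} (ht : (t : EReal) < s) :
    ∀ᶠ r : ℝ in 𝓝[≥] t, (r : EReal) < s :=
  (continuous_coe_real_ereal.continuousAt.eventually (gt_mem_nhds ht)).filter_mono
    nhdsWithin_le_nhds

/-- At every time the broadcast predictions satisfy the triggering rule. -/
theorem trigger_le (hS : S.IsDesigned) (h : S.IsExecution T x c ev xt seen) (i : Fin N) {t : ℝ}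
    (h0 : 0 ≤ t) (ht : (t : EReal) < T) :
    ∑ j, (1 + S.δ * c i j t) * S.a i j * ‖S.gain (xt i t - x i t)‖ ^ 2 ≤
      1 / 4 * ∑ j, S.a i j * ‖S.gain (xt i t - xt j t)‖ ^ 2 + S.μ := by
  choose k s hks hs0 hst hlt using fun j => h.exists_cover j h0 ht
  let g : ℝ → ℝ := fun r => ∑ j, (1 + S.δ * c i j r) * S.a i j *
      ‖S.gain (S.hold (x i) (ev i (k i)) r - x i r)‖ ^ 2
    - 1 / 4 * ∑ j, S.a i j * ‖S.gain (S.hold (x i) (ev i (k i)) r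
        - S.hold (x j) (ev j (k j)) r)‖ ^ 2 - S.μ * Real.exp (-(S.ν * r))
  have hhold : ∀ j, ContinuousWithinAt (S.hold (x j) (ev j (k j))) (Ici t) t := fun j =>
    (S.continuous_hold (x j) (ev j (k j))).continuousWithinAt
  have hgain : ∀ f : ℝ → Fin n → ℝ, ContinuousWithinAt f (Ici t) t →
      ContinuousWithinAt (fun r => ‖S.gain (f r)‖ ^ 2) (Ici t) t := fun f hf =>
    ((S.continuous_gain.norm.pow 2).continuousAt).comp_continuousWithinAt hf
  have hg : ContinuousWithinAt g (Ici t) t := by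
    refine ContinuousWithinAt.sub (ContinuousWithinAt.sub ?_ ?_) ?_
    · refine tendsto_finsetSum _ fun j _ => ?_
      refine ContinuousWithinAt.mul (ContinuousWithinAt.mul (continuousWithinAt_const.add
        (continuousWithinAt_const.mul (h.c_continuousWithinAt i j h0 ht)))
        continuousWithinAt_const) ?_
      exact hgain _ ((hhold i).sub (h.x_continuousWithinAt i h0 ht))
    · refine continuousWithinAt_const.mul (tendsto_finsetSum _ fun j _ => ?_)
      exact continuousWithinAt_const.mul (hgain _ ((hhold i).sub (hhold j)))
    · exact Continuous.continuousWithinAt (by fun_prop)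
  -- The rule is obtained as a limit from the right. At `t` itself `seen` may hold a value from
  -- before an event; strictly after `t` and before the next event of every agent it can only be the
  -- current prediction, and a positive trigger would force an earlier event.
  have hneg : ∀ᶠ r : ℝ in 𝓝[>] t, g r ≤ 0 := by
    have h1 : ∀ᶠ r : ℝ in 𝓝[>] t, (r : EReal) < T ∧ ∀ j, (r : EReal) < ev j (k j + 1) :=
      ((eventually_lt_coe ht).and (eventually_all.2 fun j => eventually_lt_coe (hlt j))).filter_mono
        (nhdsWithin_mono _ Ioi_subset_Ici_self)
    filter_upwards [h1, self_mem_nhdsWithin] with r hr (htr : t < r)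
    have hsr : ∀ j, ev j (k j) < r := fun j => by
      rw [hks j]; exact EReal.coe_lt_coe_iff.2 ((hst j).trans_lt htr)
    have hseen : ∀ j, seen i j r = S.hold (x j) (ev j (k j)) r := by
      intro j
      rcases h.seen_eq i j r (h0.trans htr.le) hr.1 with h2 | ⟨l, hl, -⟩
      · rw [h2, h.xt_eq j (k j) r (hsr j).le (hr.2 j) hr.1]
      · exfalso
        rcases le_or_gt (l + 1) (k j) with hle | hgt
        · exact absurd (h.ev_mono j hle) (not_le.2 (by rw [hl]; exact hsr j))
        · exact absurd (h.ev_mono j (Nat.succ_le_of_lt hgt)) (not_le.2 (by rw [hl]; exact hr.2 j))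
    by_contra! hpos
    have h3 : ev i (k i + 1) ≤ r := by
      rw [h.ev_succ]
      refine sInf_le ⟨r, ⟨hsr i, hr.1, ?_⟩, rfl⟩
      rw [hS.trigger_eq]
      simp_rw [hseen]
      exact hpos.le
    exact absurd (hr.2 i) (not_lt.2 h3)
  have hgt : g t ≤ 0 :=
    le_of_tendsto (hg.mono Ioi_subset_Ici_self) hneg
  have hxt : ∀ j, xt j t = S.hold (x j) (ev j (k j)) t := fun j =>
    h.xt_eq j (k j) t (by rw [hks j]; exact EReal.coe_le_coe_iff.2 (hst j)) (hlt j) ht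
  have hexp : S.μ * Real.exp (-(S.ν * t)) ≤ S.μ := by
    refine mul_le_of_le_one_right hS.μ_pos.le (Real.exp_le_one_iff.2 ?_)
    have := mul_nonneg hS.ν_pos.le h0
    linarith
  simp only [hxt]
  simp only [g] at hgt
  linarith

/-- The sampling error at the instant of the next event. -/
theorem le_error_at_event (hS : S.IsDesigned) (h : S.IsExecution T x c ev xt seen) (i : Fin N)
    {k : ℕ} {s t : ℝ} (hs : ev i k = s) (ht : ev i (k + 1) = t) :
    S.μ * Real.exp (-(S.ν * t)) ≤
      ∑ j, (1 + S.δ * c i j t) * S.a i j * ‖S.gain (S.hold (x i) s t - x i t)‖ ^ 2 := by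
  have htT : (t : EReal) < T := ht ▸ h.ev_lt_of_ne_top i (k + 1) (ht ▸ EReal.coe_ne_top t)
  have ht0 : 0 ≤ t := by
    have := h.ev_nonneg i (k + 1)
    rw [ht] at this
    exact_mod_cast this
  let F : ℝ → ℝ := fun r => ∑ j, (1 + S.δ * c i j r) * S.a i j *
    ‖S.gain (S.hold (x i) s r - x i r)‖ ^ 2 - S.μ * Real.exp (-(S.ν * r))
  have hF : ContinuousWithinAt F (Ici t) t := by
    refine ContinuousWithinAt.sub (tendsto_finsetSum _ fun j _ => ?_) ?_
    · refine ContinuousWithinAt.mul (ContinuousWithinAt.mul (continuousWithinAt_const.add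
        (continuousWithinAt_const.mul (h.c_continuousWithinAt i j ht0 htT)))
        continuousWithinAt_const) ?_
      exact ((S.continuous_gain.norm.pow 2).continuousAt).comp_continuousWithinAt
        (((S.continuous_hold (x i) s).continuousWithinAt).sub (h.x_continuousWithinAt i ht0 htT))
    · exact Continuous.continuousWithinAt (by fun_prop)
  by_contra! hlt
  have hFt : F t < 0 := by simp only [F]; linarith
  have hev := hF.eventually (gt_mem_nhds hFt)
  obtain ⟨u, hu : t < u, hsub⟩ := mem_nhdsGE_iff_exists_Ico_subset.1 hev
  -- A too small error at `t` stays too small on `[t, u)`, and the neighbor term only lowers the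
  -- trigger. So no triggering time lies before `u`, although their infimum is `t < u`.
  have hle : (u : EReal) ≤ ev i (k + 1) := by
    rw [h.ev_succ]
    refine le_sInf ?_
    rintro _ ⟨r, ⟨hkr, hrT, hr⟩, rfl⟩
    have htr : t ≤ r := by
      have : ev i (k + 1) ≤ r := by
        rw [h.ev_succ]; exact sInf_le ⟨r, ⟨hkr, hrT, hr⟩, rfl⟩
      rw [ht] at this
      exact EReal.coe_le_coe_iff.1 this
    refine EReal.coe_le_coe_iff.2 (not_lt.1 fun hru => ?_)
    have hFr : F r < 0 := hsub ⟨htr, hru⟩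
    rw [hS.trigger_eq, hs] at hr
    have hnn : 0 ≤ ∑ j, S.a i j * ‖S.gain (S.hold (x i) s r - seen i j r)‖ ^ 2 :=
      Finset.sum_nonneg fun j _ => mul_nonneg (S.a_nonneg i j) (sq_nonneg _)
    simp only [F] at hFr
    linarith
  rw [ht] at hle
  exact absurd (EReal.coe_le_coe_iff.1 hle) (not_le.2 hu)

/-- At the sample the error is zero, while an event needs an error term of at least `μ e^{-νt} > 0`.
-/
theorem lt_of_ev_eq (hS : S.IsDesigned) (h : S.IsExecution T x c ev xt seen) (i : Fin N)
    {k : ℕ} {s t : ℝ} (hs : ev i k = s) (ht : ev i (k + 1) = t) : s < t := by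
  have hle : s ≤ t := by
    have := h.ev_le_succ i k
    rw [hs, ht] at this
    exact EReal.coe_le_coe_iff.1 this
  refine lt_of_le_of_ne hle fun he => ?_
  subst he
  have h1 := h.le_error_at_event hS i hs ht
  rw [hold_self, sub_self] at h1
  have h2 : S.gain 0 = 0 := by simp [gain]
  rw [h2] at h1
  have h3 := mul_pos hS.μ_pos (Real.exp_pos (-(S.ν * s)))
  simp at h1
  linarith

/-- Growth of the sampling error between two events. -/
theorem norm_error_le (h : S.IsExecution T x c ev xt seen) (i : Fin N)
    {k : ℕ} {s t cbar σ : ℝ} (hs : ev i k = s) (ht : ev i (k + 1) = t) (hst : s ≤ t)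
    (hc : ∀ r ∈ Ico s t, ∀ j, S.G.Adj i j → |c i j r| ≤ cbar)
    (hσ : ∀ r ∈ Ico s t, S.inputSize xt i r ≤ σ) (hcbar : 0 ≤ cbar) :
    ‖WithLp.toLp 2 (S.hold (x i) s t - x i t)‖ ≤ gronwallBound 0 ‖S.A‖ (cbar * σ) (t - s) := by
  have htT : (t : EReal) < T := ht ▸ h.ev_lt_of_ne_top i (k + 1) (ht ▸ EReal.coe_ne_top t)
  have hs0 : 0 ≤ s := by
    have := h.ev_nonneg i k
    rw [hs] at this
    exact_mod_cast this
  have hg := norm_toLp_le_gronwallBound (A := S.A) (v := fun r => S.hold (x i) s r - x i r)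
    (g := fun r => -(S.B *ᵥ (S.K *ᵥ ∑ j, (c i j r * S.a i j) • (xt i r - xt j r))))
    (a := s) (b := t) (ε := cbar * σ)
    ((S.continuous_hold (x i) s).continuousOn.sub ((h.x_cont i).mono (Icc_subset hs0 htT))) ?_ ?_
    t ⟨hst, le_rfl⟩
  · simpa [hold_self] using hg
  · intro r hr
    have hrI := Icc_subset hs0 htT (Ico_subset_Icc_self hr)
    have := (S.hasDerivAt_hold (x i) s r).hasDerivWithinAt.sub (h.x_ode i r hrI.1 hrI.2)
    convert! this using 1
    rw [Matrix.mulVec_sub]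
    abel
  · intro r hr
    rw [WithLp.toLp_neg, norm_neg, Matrix.mulVec_mulVec, Matrix.mulVec_sum, WithLp.toLp_sum]
    refine (norm_sum_le _ _).trans ?_
    refine le_trans ?_ (mul_le_mul_of_nonneg_left (hσ r hr) hcbar)
    rw [inputSize, Finset.mul_sum]
    refine Finset.sum_le_sum fun j _ => ?_
    by_cases hij : S.G.Adj i j
    · rw [a_of_adj hij, mul_one, one_mul, Matrix.mulVec_smul, WithLp.toLp_smul, norm_smul,
        Real.norm_eq_abs]
      exact mul_le_mul (hc r hr j hij) (norm_toLp_mulVec_le _ _) (norm_nonneg _) hcbar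
    · rw [a_of_not_adj hij]
      simp

/-- The sampling error needed for an event, bounded by the inter-event time. -/
theorem le_gronwallBound_sq (hS : S.IsDesigned) (h : S.IsExecution T x c ev xt seen) (i : Fin N)
    {k : ℕ} {s t cbar σ : ℝ} (hs : ev i k = s) (ht : ev i (k + 1) = t)
    (hc : ∀ r ∈ Ico s t, ∀ j, S.G.Adj i j → |c i j r| ≤ cbar)
    (hσ : ∀ r ∈ Ico s t, S.inputSize xt i r ≤ σ) (hcbar : 0 ≤ cbar) :
    S.μ * Real.exp (-(S.ν * t)) ≤ S.deg i * (1 + S.δ * cbar) *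
      (‖S.K‖ * gronwallBound 0 ‖S.A‖ (cbar * σ) (t - s)) ^ 2 := by
  have hst := h.lt_of_ev_eq hS i hs ht
  have htT : (t : EReal) < T := ht ▸ h.ev_lt_of_ne_top i (k + 1) (ht ▸ EReal.coe_ne_top t)
  have hs0 : 0 ≤ s := by
    have := h.ev_nonneg i k
    rw [hs] at this
    exact_mod_cast this
  -- The hypothesis covers `[s, t)` only; continuity carries the bound to the event instant `t`.
  have hct : ∀ j, S.G.Adj i j → c i j t ≤ cbar := by
    intro j hij
    have hcont : ContinuousOn (c i j) (Icc s t) := (h.c_cont i j).mono (Icc_subset hs0 htT)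
    have h1 : ContinuousWithinAt (c i j) (Ico s t) t :=
      (hcont t ⟨hst.le, le_rfl⟩).mono Ico_subset_Icc_self
    refine h1.closure_le (by rw [closure_Ico hst.ne]; exact ⟨hst.le, le_rfl⟩)
      continuousWithinAt_const fun r hr => (le_abs_self _).trans (hc r hr j hij)
  have hgain : ‖S.gain (S.hold (x i) s t - x i t)‖ ≤
      ‖S.K‖ * gronwallBound 0 ‖S.A‖ (cbar * σ) (t - s) :=
    (S.norm_gain_le _).trans
      (mul_le_mul_of_nonneg_left (h.norm_error_le i hs ht hst.le hc hσ hcbar) (norm_nonneg _))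
  refine (h.le_error_at_event hS i hs ht).trans ?_
  rw [deg, Finset.sum_mul, Finset.sum_mul]
  refine Finset.sum_le_sum fun j _ => ?_
  by_cases hij : S.G.Adj i j
  · rw [a_of_adj hij, mul_one, one_mul]
    have h2 : 1 + S.δ * c i j t ≤ 1 + S.δ * cbar := by
      linarith [mul_le_mul_of_nonneg_left (hct j hij) hS.δ_pos.le]
    have h3 : 0 ≤ 1 + S.δ * cbar := by have := mul_nonneg hS.δ_pos.le hcbar; linarith
    exact (mul_le_mul_of_nonneg_right h2 (sq_nonneg _)).trans
      (mul_le_mul_of_nonneg_left (pow_le_pow_left₀ (norm_nonneg _) hgain 2) h3)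
  · simp [a_of_not_adj hij]

end IsExecution

end ConsensusNetwork

/-! ### Lower bounds on inter-event times -/

namespace ConsensusNetwork

open Set Filter Topology

variable {N n m : ℕ} {S : ConsensusNetwork N n m}

theorem inputSize_nonneg (S : ConsensusNetwork N n m) (xt : Fin N → ℝ → Fin n → ℝ) (i : Fin N)
    (t : ℝ) : 0 ≤ S.inputSize xt i t :=
  Finset.sum_nonneg fun j _ =>
    mul_nonneg (mul_nonneg (S.a_nonneg i j) (norm_nonneg _)) (norm_nonneg _)

theorem inputSize_le (S : ConsensusNetwork N n m) {xt : Fin N → ℝ → Fin n → ℝ} {i : Fin N}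
    {t R : ℝ} (hR : ∀ j, ‖WithLp.toLp 2 (xt j t)‖ ≤ R) :
    S.inputSize xt i t ≤ S.deg i * ‖S.B * S.K‖ * (2 * R) := by
  rw [inputSize, deg, Finset.sum_mul, Finset.sum_mul]
  refine Finset.sum_le_sum fun j _ => mul_le_mul_of_nonneg_left ?_
    (mul_nonneg (S.a_nonneg i j) (norm_nonneg _))
  rw [WithLp.toLp_sub]
  exact (norm_sub_le _ _).trans (by linarith [hR i, hR j])

theorem deg_nonneg (S : ConsensusNetwork N n m) (i : Fin N) : 0 ≤ S.deg i :=
  Finset.sum_nonneg fun j _ => S.a_nonneg i j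

theorem gronwallBound_zero_nonneg {K ε r : ℝ} (hK : 0 ≤ K) (hε : 0 ≤ ε) (hr : 0 ≤ r) :
    0 ≤ gronwallBound 0 K ε r := by
  unfold gronwallBound
  split_ifs
  · positivity
  · have : 1 ≤ Real.exp (K * r) := Real.one_le_exp (mul_nonneg hK hr)
    rw [zero_mul, zero_add]
    exact mul_nonneg (div_nonneg hε hK) (by linarith)

theorem continuous_tauRhs (S : ConsensusNetwork N n m) (i : Fin N) {cbar σ : ℝ} (s : ℝ)
    (hcbar : 0 ≤ cbar) (hσ : 0 ≤ σ) : Continuous (S.tauRhs i cbar σ s) := by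
  have hE : Continuous fun τ => √(S.μ * Real.exp (-(S.ν * (s + τ))) /
      (S.deg i * (1 + S.δ * cbar))) := by fun_prop
  by_cases hA : S.A = 0
  · have : S.tauRhs i cbar σ s = fun τ => 1 / (cbar * σ * ‖S.K‖) *
        √(S.μ * Real.exp (-(S.ν * (s + τ))) / (S.deg i * (1 + S.δ * cbar))) :=
      funext fun τ => if_pos hA
    rw [this]
    exact continuous_const.mul hE
  · have : S.tauRhs i cbar σ s = fun τ => 1 / ‖S.A‖ * Real.log (1 + ‖S.A‖ / (cbar * σ * ‖S.K‖) *
        √(S.μ * Real.exp (-(S.ν * (s + τ))) / (S.deg i * (1 + S.δ * cbar)))) :=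
      funext fun τ => if_neg hA
    rw [this]
    refine continuous_const.mul
      ((continuous_const.add (continuous_const.mul hE)).log fun τ => ?_)
    have : 0 ≤ ‖S.A‖ / (cbar * σ * ‖S.K‖) *
      √(S.μ * Real.exp (-(S.ν * (s + τ))) / (S.deg i * (1 + S.δ * cbar))) := by positivity
    exact (add_pos_of_pos_of_nonneg one_pos this).ne'

theorem tauRhs_pos (S : ConsensusNetwork N n m) (i : Fin N) {cbar σ s τ : ℝ}
    (h0 : 0 < cbar * σ * ‖S.K‖) (hD : 0 < S.deg i * (1 + S.δ * cbar)) (hμ : 0 < S.μ) :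
    0 < S.tauRhs i cbar σ s τ := by
  have hE : 0 < √(S.μ * Real.exp (-(S.ν * (s + τ))) / (S.deg i * (1 + S.δ * cbar))) := by
    positivity
  unfold tauRhs
  split_ifs with hA
  · positivity
  · have hA' : 0 < ‖S.A‖ := norm_pos_iff.2 hA
    refine mul_pos (by positivity) (Real.log_pos ?_)
    have : 0 < ‖S.A‖ / (cbar * σ * ‖S.K‖) *
      √(S.μ * Real.exp (-(S.ν * (s + τ))) / (S.deg i * (1 + S.δ * cbar))) := by positivity
    linarith

/-- The Grönwall bound from zero is `(c̄ σ/‖A‖)(e^{‖A‖τ} - 1)`, or `c̄ σ τ` if `A = 0`; the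
inequality `h` is solved for the `τ` in this bound, and the `τ` in `e^{-ν(s+τ)}` is kept. -/
theorem tauRhs_le (S : ConsensusNetwork N n m) (i : Fin N) {cbar σ s τ : ℝ}
    (h0 : 0 < cbar * σ * ‖S.K‖) (hD : 0 < S.deg i * (1 + S.δ * cbar))
    (hg : 0 ≤ gronwallBound 0 ‖S.A‖ (cbar * σ) τ)
    (h : S.μ * Real.exp (-(S.ν * (s + τ))) ≤ S.deg i * (1 + S.δ * cbar) *
      (‖S.K‖ * gronwallBound 0 ‖S.A‖ (cbar * σ) τ) ^ 2) :
    S.tauRhs i cbar σ s τ ≤ τ := by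
  have hE : √(S.μ * Real.exp (-(S.ν * (s + τ))) / (S.deg i * (1 + S.δ * cbar))) ≤
      ‖S.K‖ * gronwallBound 0 ‖S.A‖ (cbar * σ) τ := by
    refine Real.sqrt_le_iff.2 ⟨by positivity, ?_⟩
    rw [div_le_iff₀ hD]
    linarith
  set E := √(S.μ * Real.exp (-(S.ν * (s + τ))) / (S.deg i * (1 + S.δ * cbar))) with hEdef
  have hne : cbar * σ * ‖S.K‖ ≠ 0 := h0.ne'
  have hK : ‖S.K‖ ≠ 0 := right_ne_zero_of_mul hne
  have hc : cbar ≠ 0 := left_ne_zero_of_mul (left_ne_zero_of_mul hne)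
  have hσ : σ ≠ 0 := right_ne_zero_of_mul (left_ne_zero_of_mul hne)
  unfold tauRhs
  rw [← hEdef]
  split_ifs with hA
  · rw [hA, norm_zero, gronwallBound_K0] at hE
    rw [one_div, ← div_eq_inv_mul, div_le_iff₀ h0]
    simp only at hE
    linarith
  · have hA' : 0 < ‖S.A‖ := norm_pos_iff.2 hA
    rw [gronwallBound_of_K_ne_0 hA'.ne'] at hE
    simp only [zero_mul, zero_add] at hE
    rw [one_div, ← div_eq_inv_mul, div_le_iff₀ hA']
    have h1 : ‖S.A‖ / (cbar * σ * ‖S.K‖) * E ≤ Real.exp (‖S.A‖ * τ) - 1 := by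
      calc ‖S.A‖ / (cbar * σ * ‖S.K‖) * E ≤ ‖S.A‖ / (cbar * σ * ‖S.K‖) *
            (‖S.K‖ * (cbar * σ / ‖S.A‖ * (Real.exp (‖S.A‖ * τ) - 1))) :=
            mul_le_mul_of_nonneg_left hE (by positivity)
        _ = Real.exp (‖S.A‖ * τ) - 1 := by
            field_simp
    have hpos : 0 < 1 + ‖S.A‖ / (cbar * σ * ‖S.K‖) * E := by positivity
    rw [Real.log_le_iff_le_exp hpos, mul_comm τ]
    linarith

namespace IsExecution

variable {T : EReal} {x : Fin N → ℝ → Fin n → ℝ} {c : Fin N → Fin N → ℝ → ℝ}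
  {ev : Fin N → ℕ → EReal} {xt : Fin N → ℝ → Fin n → ℝ} {seen : Fin N → Fin N → ℝ → Fin n → ℝ}

/-- An agent with an event after time `0` has a neighbor. -/
theorem exists_adj (hS : S.IsDesigned) (h : S.IsExecution T x c ev xt seen) (i : Fin N)
    {k : ℕ} {s t : ℝ} (hs : ev i k = s) (ht : ev i (k + 1) = t) : ∃ j, S.G.Adj i j := by
  by_contra! hn
  have h1 := h.le_error_at_event hS i hs ht
  simp only [fun j => a_of_not_adj (hn j), mul_zero, zero_mul, Finset.sum_const_zero] at h1
  have h3 := mul_pos hS.μ_pos (Real.exp_pos (-(S.ν * t)))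
  linarith

/-- `tauRhs` is continuous, positive at `0` and at most `t - s` at `t - s`, so it has a fixed point
in between. -/
theorem exists_interevent_bound (hS : S.IsDesigned) (h : S.IsExecution T x c ev xt seen)
    (i : Fin N) {k : ℕ} {s t cbar σ : ℝ} (hs : ev i k = s) (ht : ev i (k + 1) = t)
    (hc : ∀ r ∈ Ico s t, ∀ j, S.G.Adj i j → |c i j r| ≤ cbar)
    (hσ : ∀ r ∈ Ico s t, S.inputSize xt i r ≤ σ) :
    ∃ τ, 0 < τ ∧ τ = S.tauRhs i cbar σ s τ ∧ s + τ ≤ t := by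
  have hst := h.lt_of_ev_eq hS i hs ht
  obtain ⟨j₀, hj₀⟩ := h.exists_adj hS i hs ht
  have hcbar : 0 ≤ cbar := (abs_nonneg _).trans (hc s ⟨le_rfl, hst⟩ j₀ hj₀)
  have hσ0 : 0 ≤ σ := (S.inputSize_nonneg xt i s).trans (hσ s ⟨le_rfl, hst⟩)
  have hdeg : 0 < S.deg i := by
    refine Finset.sum_pos' (fun j _ => S.a_nonneg i j) ⟨j₀, Finset.mem_univ _, ?_⟩
    rw [a_of_adj hj₀]; exact one_pos
  have hD : 0 < S.deg i * (1 + S.δ * cbar) :=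
    mul_pos hdeg (by have := mul_nonneg hS.δ_pos.le hcbar; linarith)
  have hmain := h.le_gronwallBound_sq hS i hs ht hc hσ hcbar
  have hμ := mul_pos hS.μ_pos (Real.exp_pos (-(S.ν * t)))
  have hg := gronwallBound_zero_nonneg (norm_nonneg S.A) (mul_nonneg hcbar hσ0)
    (sub_nonneg.2 hst.le)
  -- If `c̄`, `σ` or `‖K‖` vanished, the error could not reach the positive level needed for the
  -- event; so the denominators in `tauRhs` are nonzero.
  have hKg : ‖S.K‖ * gronwallBound 0 ‖S.A‖ (cbar * σ) (t - s) ≠ 0 := fun h0 => by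
    rw [h0] at hmain
    simp at hmain
    linarith
  have hcσ : cbar * σ ≠ 0 := fun h0 => by
    rw [h0, gronwallBound_ε0_δ0, mul_zero] at hKg
    exact hKg rfl
  have h0 : 0 < cbar * σ * ‖S.K‖ :=
    mul_pos (lt_of_le_of_ne (mul_nonneg hcbar hσ0) hcσ.symm)
      (lt_of_le_of_ne (norm_nonneg _) (left_ne_zero_of_mul hKg).symm)
  have hle : S.tauRhs i cbar σ s (t - s) ≤ t - s :=
    S.tauRhs_le i h0 hD hg (by rwa [add_sub_cancel])
  have hcont : ContinuousOn (fun τ => τ - S.tauRhs i cbar σ s τ) (Icc 0 (t - s)) :=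
    (continuous_id.sub (S.continuous_tauRhs i s hcbar hσ0)).continuousOn
  have hneg : (0 : ℝ) - S.tauRhs i cbar σ s 0 ≤ 0 := by
    linarith [S.tauRhs_pos i (s := s) (τ := 0) h0 hD hS.μ_pos]
  obtain ⟨τ, hτ, hτ0⟩ := intermediate_value_Icc (sub_nonneg.2 hst.le) hcont
    (show (0 : ℝ) ∈ Icc _ _ from ⟨hneg, by simpa using hle⟩)
  have hτ1 : τ = S.tauRhs i cbar σ s τ := sub_eq_zero.1 hτ0
  refine ⟨τ, ?_, hτ1, by linarith [hτ.2]⟩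
  rw [hτ1]
  exact S.tauRhs_pos i h0 hD hS.μ_pos

theorem finite_events_of_lt (h : S.IsExecution T x c ev xt seen) (i : Fin N) {t : ℝ}
    (ht : (t : EReal) < T) : {k : ℕ | ev i k ≤ t}.Finite := by
  -- Covering intervals are available at nonnegative times only.
  have hmax : ((max t 0 : ℝ) : EReal) < T := by
    rcases max_choice t 0 with hm | hm <;> rw [hm]
    · exact ht
    · exact h.T_pos
  obtain ⟨k, s, -, -, -, hk⟩ := h.exists_cover i (le_max_right t 0) hmax
  refine (finite_Iio (k + 1)).subset fun l hl => ?_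
  by_contra hkl
  have h1 : ev i (k + 1) ≤ ev i l := h.ev_mono i (not_lt.1 hkl)
  have h2 : (t : EReal) ≤ (max t 0 : ℝ) := EReal.coe_le_coe_iff.2 (le_max_left _ _)
  exact absurd (h1.trans (le_trans hl h2)) (not_le.2 hk)

/-- Bounded weights and inputs on a bounded time interval exclude Zeno behavior. -/
theorem finite_events_of_bounded (hS : S.IsDesigned) (h : S.IsExecution T x c ev xt seen)
    (i : Fin N) {b cbar σ : ℝ} (hT : T ≤ b)
    (hc : ∀ t : ℝ, 0 ≤ t → t < T → ∀ j, S.G.Adj i j → |c i j t| ≤ cbar)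
    (hσ : ∀ t : ℝ, 0 ≤ t → t < T → S.inputSize xt i t ≤ σ) (hcbar : 0 ≤ cbar) (t : ℝ) :
    {k : ℕ | ev i k ≤ t}.Finite := by
  have hcont : Continuous fun r => S.deg i * (1 + S.δ * cbar) *
      (‖S.K‖ * gronwallBound 0 ‖S.A‖ (cbar * σ) r) ^ 2 := by
    have : Continuous (gronwallBound 0 ‖S.A‖ (cbar * σ)) :=
      continuous_iff_continuousAt.2 fun r => (hasDerivAt_gronwallBound _ _ _ r).continuousAt
    fun_prop
  have hμ := mul_pos hS.μ_pos (Real.exp_pos (-(S.ν * b)))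
  have hlt : S.deg i * (1 + S.δ * cbar) *
      (‖S.K‖ * gronwallBound 0 ‖S.A‖ (cbar * σ) 0) ^ 2 < S.μ * Real.exp (-(S.ν * b)) := by
    rw [gronwallBound_x0]
    simpa using hμ
  -- For gaps below `ε` the error bound stays under `μ e^{-νb}`, the smallest threshold before `b`;
  -- hence consecutive events are at least `ε` apart.
  obtain ⟨ε, hε, hball⟩ := Metric.eventually_nhds_iff.1
    (hcont.continuousAt.eventually (gt_mem_nhds hlt))
  have hgap : ∀ (k : ℕ) (s r : ℝ), ev i k = s → ev i (k + 1) = r → s + ε ≤ r := by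
    intro k s r hs hr
    have hsr := h.lt_of_ev_eq hS i hs hr
    have hrT : (r : EReal) < T := hr ▸ h.ev_lt_of_ne_top i (k + 1) (hr ▸ EReal.coe_ne_top r)
    have hs0 : 0 ≤ s := by
      have := h.ev_nonneg i k
      rw [hs] at this
      exact_mod_cast this
    have hI := Icc_subset hs0 hrT
    have h1 := h.le_gronwallBound_sq hS i hs hr
      (fun q hq => hc q (hI (Ico_subset_Icc_self hq)).1 (hI (Ico_subset_Icc_self hq)).2)
      (fun q hq => hσ q (hI (Ico_subset_Icc_self hq)).1 (hI (Ico_subset_Icc_self hq)).2) hcbar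
    by_contra! hlt'
    have h2 := hball (y := r - s) (by
      rw [Real.dist_eq, sub_zero, abs_of_pos (sub_pos.2 hsr)]; linarith)
    have hrb : r ≤ b := EReal.coe_le_coe_iff.1 (hrT.le.trans hT)
    have h3 : S.μ * Real.exp (-(S.ν * b)) ≤ S.μ * Real.exp (-(S.ν * r)) :=
      mul_le_mul_of_nonneg_left (Real.exp_le_exp.2
        (neg_le_neg (mul_le_mul_of_nonneg_left hrb hS.ν_pos.le))) hS.μ_pos.le
    linarith
  have hlow : ∀ (k : ℕ) (r : ℝ), ev i k = r → k * ε ≤ r := by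
    intro k
    induction k with
    | zero =>
      intro r hr
      rw [h.ev_zero] at hr
      have : (0 : ℝ) = r := by exact_mod_cast hr
      simp [← this]
    | succ k ih =>
      intro r hr
      obtain ⟨s, -, -, hs⟩ := h.exists_ev_eq_coe i k
        ((h.ev_le_succ i k).trans_lt (hr ▸ EReal.coe_lt_top r)).ne
      have := hgap k s r hs hr
      have := ih s hs
      push_cast
      linarith
  refine (finite_Iic ⌊t / ε⌋₊).subset fun k (hk : ev i k ≤ t) => ?_
  obtain ⟨s, -, -, hs⟩ := h.exists_ev_eq_coe i k (hk.trans_lt (EReal.coe_lt_top t)).ne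
  rw [hs] at hk
  refine Nat.le_floor ?_
  rw [le_div_iff₀ hε]
  exact (hlow k s hs).trans (EReal.coe_le_coe_iff.1 hk)

/-- A bound on the past states bounds the current prediction. -/
theorem norm_xt_le (h : S.IsExecution T x c ev xt seen) (i : Fin N) {t R : ℝ}
    (h0 : 0 ≤ t) (ht : (t : EReal) < T) (hR : ∀ s ∈ Icc 0 t, ‖WithLp.toLp 2 (x i s)‖ ≤ R) :
    ‖WithLp.toLp 2 (xt i t)‖ ≤ R * Real.exp (‖S.A‖ * t) := by
  obtain ⟨k, s, hs, hs0, hst, hlt⟩ := h.exists_cover i h0 ht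
  rw [h.xt_eq i k t (hs ▸ EReal.coe_le_coe_iff.2 hst) hlt ht, hs]
  refine (S.norm_hold_le (x i) hst).trans ?_
  refine mul_le_mul (hR s ⟨hs0, hst⟩) (Real.exp_le_exp.2
    (mul_le_mul_of_nonneg_left (by linarith) (norm_nonneg _))) (Real.exp_pos _).le ?_
  exact (norm_nonneg _).trans (hR s ⟨hs0, hst⟩)

/-- Predictions jump, so compactness is applied to the states, which bound the predictions. -/
theorem exists_inputSize_le (h : S.IsExecution T x c ev xt seen) (i : Fin N) {b : ℝ}
    (hb : (b : EReal) < T) :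
    ∃ σ : ℝ, 0 < σ ∧ ∀ t ∈ Icc 0 b, S.inputSize xt i t ≤ σ := by
  have hx : ∀ j, ∃ R : ℝ, ∀ t ∈ Icc 0 b, ‖WithLp.toLp 2 (x j t)‖ ≤ R := fun j =>
    isCompact_Icc.exists_bound_of_continuousOn
      (continuous_toLp_two.comp_continuousOn ((h.x_cont j).mono (Icc_subset le_rfl hb)))
  choose R hR using hx
  set M := ∑ j, |R j| with hM
  have hM0 : 0 ≤ M := Finset.sum_nonneg fun j _ => abs_nonneg _
  have hRM : ∀ j, ∀ t ∈ Icc 0 b, ‖WithLp.toLp 2 (x j t)‖ ≤ M := fun j t ht =>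
    (hR j t ht).trans ((le_abs_self _).trans
      (Finset.single_le_sum (f := fun j => |R j|) (fun j _ => abs_nonneg _) (Finset.mem_univ j)))
  refine ⟨S.deg i * ‖S.B * S.K‖ * (2 * (M * Real.exp (‖S.A‖ * b))) + 1, ?_, fun t ht => ?_⟩
  · have := S.deg_nonneg i
    positivity
  · refine (S.inputSize_le fun j => ?_).trans (le_add_of_nonneg_right zero_le_one)
    have htT := (Icc_subset le_rfl hb ht).2
    refine (h.norm_xt_le j ht.1 htT fun s hs => hRM j s ⟨hs.1, hs.2.trans ht.2⟩).trans ?_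
    exact mul_le_mul_of_nonneg_left (Real.exp_le_exp.2
      (mul_le_mul_of_nonneg_left ht.2 (norm_nonneg _))) hM0

end IsExecution

end ConsensusNetwork

theorem exists_pos_forall_le {ι : Type*} [Finite ι] (f : ι → ℝ) (hf : ∀ i, 0 < f i) :
    ∃ l : ℝ, 0 < l ∧ ∀ i, l ≤ f i := by
  rcases isEmpty_or_nonempty ι with hι | hι
  · exact ⟨1, one_pos, fun i => isEmptyElim i⟩
  · obtain ⟨i, hi⟩ := Finite.exists_min f
    exact ⟨f i, hf i, hi⟩

/-! ### The energy -/

namespace ConsensusNetwork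

open Set Filter Topology

variable {N n m : ℕ} {S : ConsensusNetwork N n m}

/-- Disagreement energy plus adaptation energy. -/
noncomputable def energy (S : ConsensusNetwork N n m) (α : ℝ) (x : Fin N → Fin n → ℝ)
    (c : Fin N → Fin N → ℝ) : ℝ :=
  1 / 4 * ∑ i, ∑ j, (x i - x j) ⬝ᵥ S.P *ᵥ (x i - x j) +
    N * ∑ i, ∑ j, S.a i j * ((c i j - α) ^ 2 / (8 * S.κ i j))

namespace IsDesigned

theorem dotProduct_P_nonneg (hS : S.IsDesigned) (v : Fin n → ℝ) : 0 ≤ v ⬝ᵥ S.P *ᵥ v := by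
  have := hS.posDef.posSemidef.dotProduct_mulVec_nonneg v
  rwa [star_trivial] at this

theorem adaptation_nonneg (hS : S.IsDesigned) (α : ℝ) (c : Fin N → Fin N → ℝ) (i j : Fin N) :
    0 ≤ S.a i j * ((c i j - α) ^ 2 / (8 * S.κ i j)) := by
  by_cases hij : S.G.Adj i j
  · have := hS.κ_pos i j hij
    have := S.a_nonneg i j
    positivity
  · simp [a_of_not_adj hij]

theorem card_pos (hS : S.IsDesigned) : 0 < (N : ℝ) := by
  have := hS.connected.nonempty
  exact_mod_cast Fin.pos_iff_nonempty.2 this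

theorem disagreement_le_energy (hS : S.IsDesigned) (α : ℝ) (x : Fin N → Fin n → ℝ)
    (c : Fin N → Fin N → ℝ) (i j : Fin N) :
    (x i - x j) ⬝ᵥ S.P *ᵥ (x i - x j) ≤ 4 * S.energy α x c := by
  have h1 : 0 ≤ (N : ℝ) * ∑ i, ∑ j, S.a i j * ((c i j - α) ^ 2 / (8 * S.κ i j)) :=
    mul_nonneg hS.card_pos.le (Finset.sum_nonneg fun i _ => Finset.sum_nonneg fun j _ =>
      hS.adaptation_nonneg α c i j)
  have h2 : (x i - x j) ⬝ᵥ S.P *ᵥ (x i - x j) ≤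
      ∑ i, ∑ j, (x i - x j) ⬝ᵥ S.P *ᵥ (x i - x j) :=
    (Finset.single_le_sum (f := fun j => (x i - x j) ⬝ᵥ S.P *ᵥ (x i - x j))
      (fun j _ => hS.dotProduct_P_nonneg _) (Finset.mem_univ j)).trans
      (Finset.single_le_sum (f := fun i => ∑ j, (x i - x j) ⬝ᵥ S.P *ᵥ (x i - x j))
        (fun i _ => Finset.sum_nonneg fun j _ => hS.dotProduct_P_nonneg _) (Finset.mem_univ i))
  unfold energy
  linarith

theorem energy_nonneg (hS : S.IsDesigned) (α : ℝ) (x : Fin N → Fin n → ℝ)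
    (c : Fin N → Fin N → ℝ) : 0 ≤ S.energy α x c := by
  obtain ⟨i⟩ := hS.connected.nonempty
  have := hS.disagreement_le_energy α x c i i
  simp at this
  exact this

/-- A single edge term is at most the energy since `N ≥ 1`; `|u| ≤ 1 + u²` then removes the square.
-/
theorem abs_weight_le (hS : S.IsDesigned) (α : ℝ) (x : Fin N → Fin n → ℝ)
    (c : Fin N → Fin N → ℝ) {i j : Fin N} (hij : S.G.Adj i j) :
    |c i j| ≤ |α| + 1 + 8 * S.κ i j * S.energy α x c := by
  have hκ := hS.κ_pos i j hij
  have h1 : 0 ≤ 1 / 4 * ∑ i, ∑ j, (x i - x j) ⬝ᵥ S.P *ᵥ (x i - x j) :=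
    mul_nonneg (by norm_num) (Finset.sum_nonneg fun i _ => Finset.sum_nonneg fun j _ =>
      hS.dotProduct_P_nonneg _)
  have h2 : S.a i j * ((c i j - α) ^ 2 / (8 * S.κ i j)) ≤
      ∑ i, ∑ j, S.a i j * ((c i j - α) ^ 2 / (8 * S.κ i j)) :=
    (Finset.single_le_sum (f := fun j => S.a i j * ((c i j - α) ^ 2 / (8 * S.κ i j)))
      (fun j _ => hS.adaptation_nonneg α c i j) (Finset.mem_univ j)).trans
      (Finset.single_le_sum (f := fun i => ∑ j, S.a i j * ((c i j - α) ^ 2 / (8 * S.κ i j)))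
        (fun i _ => Finset.sum_nonneg fun j _ => hS.adaptation_nonneg α c i j)
        (Finset.mem_univ i))
  have h3 : (1 : ℝ) ≤ N := by exact_mod_cast Nat.one_le_iff_ne_zero.2 (by
    have := hS.card_pos; intro h0; simp [h0] at this)
  have h4 : (c i j - α) ^ 2 / (8 * S.κ i j) ≤ S.energy α x c := by
    have h5 := hS.adaptation_nonneg α c i j
    rw [a_of_adj hij, one_mul] at h2 h5
    have h6 := mul_le_mul h3 h2 h5 hS.card_pos.le
    unfold energy
    linarith
  rw [div_le_iff₀ (by positivity)] at h4
  have h7 : |c i j| ≤ |α| + |c i j - α| := by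
    have := abs_add_le α (c i j - α)
    rwa [add_sub_cancel] at this
  have h8 : |c i j - α| ≤ 1 + (c i j - α) ^ 2 := by
    rw [← sq_abs]
    nlinarith [sq_nonneg (|c i j - α| - 1), abs_nonneg (c i j - α)]
  linarith

/-- The decay terms of the energy derivative dominate a multiple of the energy. -/
theorem exists_decay_rate (hS : S.IsDesigned) :
    ∃ l : ℝ, 0 < l ∧ ∀ (α : ℝ) (x : Fin N → Fin n → ℝ) (c : Fin N → Fin N → ℝ),
      l * S.energy α x c ≤ 1 / 4 * ∑ i, ∑ j, (x i - x j) ⬝ᵥ (x i - x j) +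
        N / 8 * ∑ i, ∑ j, S.a i j * (S.ϱ i j * (c i j - α) ^ 2) := by
  classical
  obtain ⟨l₁, hl₁, h1⟩ := exists_pos_forall_le
    (fun p : Fin N × Fin N => if S.G.Adj p.1 p.2 then S.ϱ p.1 p.2 * S.κ p.1 p.2 else 1) (by
      rintro ⟨i, j⟩
      simp only
      split_ifs with hij
      · exact mul_pos (hS.ϱ_pos i j hij) (hS.κ_pos i j hij)
      · exact one_pos)
  -- `l₁` bounds `ϱ κ` below on the edges, and `1/(‖P‖ + 1)` serves the disagreement part through
  -- `vᵀPv ≤ ‖P‖ |v|²`.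
  have hl : 0 < min l₁ (1 / (‖S.P‖ + 1)) := lt_min hl₁ (by positivity)
  refine ⟨_, hl, fun α x c => ?_⟩
  set l := min l₁ (1 / (‖S.P‖ + 1)) with hldef
  unfold energy
  rw [mul_add]
  refine add_le_add ?_ ?_
  · rw [mul_left_comm, Finset.mul_sum]
    refine mul_le_mul_of_nonneg_left (Finset.sum_le_sum fun i _ => ?_) (by norm_num)
    rw [Finset.mul_sum]
    refine Finset.sum_le_sum fun j _ => ?_
    have h2 := dotProduct_mulVec_self_le S.P (x i - x j)
    rw [norm_toLp_sq] at h2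
    have h3 : l * (‖S.P‖ + 1) ≤ 1 := by
      rw [← le_div_iff₀ (by positivity)]; exact min_le_right _ _
    have h4 : 0 ≤ (x i - x j) ⬝ᵥ (x i - x j) := by rw [← norm_toLp_sq]; positivity
    nlinarith [mul_le_mul_of_nonneg_left h2 hl.le, mul_le_mul_of_nonneg_right h3 h4,
      mul_nonneg hl.le h4]
  · rw [mul_left_comm, div_eq_mul_inv, mul_assoc]
    refine mul_le_mul_of_nonneg_left ?_ hS.card_pos.le
    rw [Finset.mul_sum, Finset.mul_sum]
    refine Finset.sum_le_sum fun i _ => ?_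
    rw [Finset.mul_sum, Finset.mul_sum]
    refine Finset.sum_le_sum fun j _ => ?_
    by_cases hij : S.G.Adj i j
    · rw [a_of_adj hij, one_mul, one_mul]
      have hκ := hS.κ_pos i j hij
      have h2 : l ≤ S.ϱ i j * S.κ i j := by
        have := h1 (i, j)
        simp only [if_pos hij] at this
        exact (min_le_left _ _).trans this
      rw [← mul_div_assoc, div_le_iff₀ (by positivity)]
      nlinarith [mul_le_mul_of_nonneg_right h2 (sq_nonneg (c i j - α))]
    · simp [a_of_not_adj hij]

end IsDesigned

/-! ### Weights, energy and mean along a solution -/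

namespace IsExecution

variable {T : EReal} {x : Fin N → ℝ → Fin n → ℝ} {c : Fin N → Fin N → ℝ → ℝ}
  {ev : Fin N → ℕ → EReal} {xt : Fin N → ℝ → Fin n → ℝ} {seen : Fin N → Fin N → ℝ → Fin n → ℝ}

theorem weight_deriv (hS : S.IsDesigned) (h : S.IsExecution T x c ev xt seen) {i j : Fin N}
    (hij : S.G.Adj i j) {t : ℝ} (h0 : 0 ≤ t) (ht : (t : EReal) < T) :
    HasDerivWithinAt (c i j) (S.κ i j *
      (-(S.ϱ i j * c i j t) + ‖S.gain (xt i t) - S.gain (xt j t)‖ ^ 2)) (Ici t) t := by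
  have := h.c_ode i j t h0 ht
  rwa [a_of_adj hij, mul_one, hS.dotProduct_Γ_mulVec_self, gain_sub] at this

/-- The quadratic input is the same for both orientations, so `z = cᵢⱼ - cⱼᵢ` solves `ż = -κ ϱ z`
from `z(0) = 0`. -/
theorem weight_symm (hS : S.IsDesigned) (h : S.IsExecution T x c ev xt seen) {i j : Fin N}
    (hij : S.G.Adj i j) {t : ℝ} (h0 : 0 ≤ t) (ht : (t : EReal) < T) : c i j t = c j i t := by
  have hI := Icc_subset le_rfl ht
  have := eq_zero_of_abs_deriv_le_mul_abs_self_of_eq_zero_right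
    (f := fun r => c i j r - c j i r) (a := 0) (b := t) (K := |S.κ i j * S.ϱ i j|)
    (((h.c_cont i j).mono hI).sub ((h.c_cont j i).mono hI))
    (fun r hr => (h.weight_deriv hS hij (hI (Ico_subset_Icc_self hr)).1
      (hI (Ico_subset_Icc_self hr)).2).sub (h.weight_deriv hS hij.symm
        (hI (Ico_subset_Icc_self hr)).1 (hI (Ico_subset_Icc_self hr)).2))
    (sub_eq_zero.2 (h.c_symm i j hij)) (fun r _ => by
      rw [← hS.κ_symm i j hij, ← hS.ϱ_symm i j hij,
        norm_sub_rev (S.gain (xt j r)) (S.gain (xt i r)), Real.norm_eq_abs, Real.norm_eq_abs,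
        ← abs_mul, ← abs_neg]
      refine le_of_eq (congrArg _ ?_)
      ring) t ⟨h0, le_rfl⟩
  exact sub_eq_zero.1 this

theorem coupling_symm (hS : S.IsDesigned) (h : S.IsExecution T x c ev xt seen) (i j : Fin N)
    {t : ℝ} (h0 : 0 ≤ t) (ht : (t : EReal) < T) :
    c i j t * S.a i j = c j i t * S.a j i := by
  rw [S.a_symm j i]
  by_cases hij : S.G.Adj i j
  · rw [h.weight_symm hS hij h0 ht]
  · rw [a_of_not_adj hij, mul_zero, mul_zero]

/-- The quadratic input is nonnegative, so `cᵢⱼ e^{κϱt}` is nondecreasing. -/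
theorem le_weight (hS : S.IsDesigned) (h : S.IsExecution T x c ev xt seen) {i j : Fin N}
    (hij : S.G.Adj i j) {t : ℝ} (h0 : 0 ≤ t) (ht : (t : EReal) < T) :
    c i j 0 * Real.exp (-(S.κ i j * S.ϱ i j * t)) ≤ c i j t := by
  have hI := Icc_subset le_rfl ht
  set l := S.κ i j * S.ϱ i j with hl
  have hexp : ∀ r, HasDerivAt (fun r => Real.exp (l * r)) (Real.exp (l * r) * l) r := fun r => by
    simpa using ((hasDerivAt_id r).const_mul l).exp
  have := image_le_of_deriv_right_le_deriv_boundary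
    (f := fun r => -(c i j r * Real.exp (l * r))) (a := 0) (b := t)
    (B := fun _ => -c i j 0) (B' := fun _ => 0)
    (((h.c_cont i j).mono hI).mul (Continuous.continuousOn (by fun_prop))).neg
    (fun r hr => ((h.weight_deriv hS hij (hI (Ico_subset_Icc_self hr)).1
      (hI (Ico_subset_Icc_self hr)).2).mul (hexp r).hasDerivWithinAt).neg)
    (by simp) continuousOn_const (fun r _ => hasDerivWithinAt_const r _ _) (fun r _ => by
      have hκ := hS.κ_pos i j hij
      have : 0 ≤ S.κ i j * ‖S.gain (xt i r) - S.gain (xt j r)‖ ^ 2 * Real.exp (l * r) := by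
        positivity
      rw [← neg_nonneg]
      refine this.trans_eq ?_
      rw [hl]
      ring) (right_mem_Icc.2 h0)
  have h1 : Real.exp (l * t) * Real.exp (-(l * t)) = 1 := by
    rw [← Real.exp_add, add_neg_cancel, Real.exp_zero]
  have h2 := mul_le_mul_of_nonneg_right (neg_le_neg_iff.1 this) (Real.exp_pos (-(l * t))).le
  rwa [mul_assoc (c i j t), h1, mul_one] at h2

theorem neg_abs_le_weight (hS : S.IsDesigned) (h : S.IsExecution T x c ev xt seen) {i j : Fin N}
    (hij : S.G.Adj i j) {t : ℝ} (h0 : 0 ≤ t) (ht : (t : EReal) < T) :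
    -(|c i j 0| * Real.exp (-(S.κ i j * S.ϱ i j * t))) ≤ c i j t := by
  refine le_trans ?_ (h.le_weight hS hij h0 ht)
  rw [← neg_mul]
  exact mul_le_mul_of_nonneg_right (neg_abs_le _) (Real.exp_pos _).le

/-- The right derivative of the energy along a solution. -/
theorem hasDerivWithinAt_energy (hS : S.IsDesigned) (h : S.IsExecution T x c ev xt seen) (α : ℝ)
    {t : ℝ} (h0 : 0 ≤ t) (ht : (t : EReal) < T) :
    HasDerivWithinAt (fun r => S.energy α (fun i => x i r) (fun i j => c i j r))
      (-(1 / 2 * ∑ i, ∑ j, inner ℝ (S.gain (x i t) - S.gain (x j t))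
          (∑ l, (c i l t * S.a i l) • (S.gain (xt i t) - S.gain (xt l t))
            - ∑ l, (c j l t * S.a j l) • (S.gain (xt j t) - S.gain (xt l t))))
        + 1 / 4 * ∑ i, ∑ j, ‖S.gain (x i t) - S.gain (x j t)‖ ^ 2
        + N * ∑ i, ∑ j, S.a i j * (1 / 4 * (c i j t - α) *
            (-(S.ϱ i j * c i j t) + ‖S.gain (xt i t) - S.gain (xt j t)‖ ^ 2))
        - 1 / 4 * ∑ i, ∑ j, (x i t - x j t) ⬝ᵥ (x i t - x j t)) (Ici t) t := by
  have hx : ∀ i j, HasDerivWithinAt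
      (fun r => (x i r - x j r) ⬝ᵥ S.P *ᵥ (x i r - x j r))
      (-2 * inner ℝ (S.gain (x i t) - S.gain (x j t))
          (∑ l, (c i l t * S.a i l) • (S.gain (xt i t) - S.gain (xt l t))
            - ∑ l, (c j l t * S.a j l) • (S.gain (xt j t) - S.gain (xt l t)))
        + ‖S.gain (x i t) - S.gain (x j t)‖ ^ 2
        - (x i t - x j t) ⬝ᵥ (x i t - x j t)) (Ici t) t := by
    intro i j
    have hd := (h.x_ode i t h0 ht).sub (h.x_ode j t h0 ht)
    have hq := hd.dotProduct (hd.matrix_mulVec S.P)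
    convert! hq using 1
    set ui := ∑ l, (c i l t * S.a i l) • (xt i t - xt l t)
    set uj := ∑ l, (c j l t * S.a j l) • (xt j t - xt l t)
    have e1 : S.A *ᵥ x i t + S.B *ᵥ (S.K *ᵥ ui) - (S.A *ᵥ x j t + S.B *ᵥ (S.K *ᵥ uj)) =
        S.A *ᵥ (x i t - x j t) + S.B *ᵥ (S.K *ᵥ (ui - uj)) := by
      simp only [Matrix.mulVec_sub]; abel
    have e2 : S.gain (ui - uj) =
        ∑ l, (c i l t * S.a i l) • (S.gain (xt i t) - S.gain (xt l t))
            - ∑ l, (c j l t * S.a j l) • (S.gain (xt j t) - S.gain (xt l t)) := by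
      rw [gain_sub, gain_sum_smul, gain_sum_smul]
      simp only [gain_sub]
    simp only [Pi.sub_apply]
    rw [e1, hS.dotProduct_P_mulVec_comm (S.A *ᵥ (x i t - x j t) + S.B *ᵥ (S.K *ᵥ (ui - uj))),
      Matrix.mulVec_add, dotProduct_add, hS.dotProduct_PA_mulVec_self,
      hS.dotProduct_PB_mulVec, e2, gain_sub]
    ring
  have hc : ∀ i j, HasDerivWithinAt
      (fun r => S.a i j * ((c i j r - α) ^ 2 / (8 * S.κ i j)))
      (S.a i j * (1 / 4 * (c i j t - α) *
            (-(S.ϱ i j * c i j t) + ‖S.gain (xt i t) - S.gain (xt j t)‖ ^ 2))) (Ici t) t := by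
    intro i j
    by_cases hij : S.G.Adj i j
    · have hκ := (hS.κ_pos i j hij).ne'
      have := ((((h.weight_deriv hS hij h0 ht).sub_const α).fun_pow 2).div_const
        (8 * S.κ i j)).const_mul (S.a i j)
      convert! this using 1
      field_simp
      ring
    · simp only [a_of_not_adj hij, zero_mul]
      exact hasDerivWithinAt_const _ _ _
  have hsum := ((HasDerivWithinAt.fun_sum fun i (_ : i ∈ Finset.univ) =>
    HasDerivWithinAt.fun_sum fun j (_ : j ∈ Finset.univ) => hx i j).const_mul (1 / 4 : ℝ)).add
    ((HasDerivWithinAt.fun_sum fun i (_ : i ∈ Finset.univ) =>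
      HasDerivWithinAt.fun_sum fun j (_ : j ∈ Finset.univ) => hc i j).const_mul (N : ℝ))
  convert! hsum using 1
  simp only [Finset.sum_add_distrib, Finset.sum_sub_distrib, ← Finset.mul_sum]
  ring

theorem continuousOn_energy (h : S.IsExecution T x c ev xt seen) (α : ℝ) :
    ContinuousOn (fun r => S.energy α (fun i => x i r) (fun i j => c i j r))
      {t : ℝ | 0 ≤ t ∧ (t : EReal) < T} := by
  unfold energy
  refine ContinuousOn.add (continuousOn_const.mul ?_) (continuousOn_const.mul ?_)
  · refine continuousOn_finsetSum _ fun i _ => continuousOn_finsetSum _ fun j _ => ?_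
    have hq : Continuous fun v : Fin n → ℝ => v ⬝ᵥ S.P *ᵥ v :=
      Continuous.dotProduct continuous_id (Continuous.matrix_mulVec continuous_const continuous_id)
    exact hq.comp_continuousOn ((h.x_cont i).sub (h.x_cont j))
  · refine continuousOn_finsetSum _ fun i _ => continuousOn_finsetSum _ fun j _ => ?_
    exact continuousOn_const.mul ((((h.c_cont i j).sub continuousOn_const).pow 2).div_const _)

/-- The mean state follows the uncontrolled dynamics. -/
theorem norm_sum_state_le (hS : S.IsDesigned) (h : S.IsExecution T x c ev xt seen) {t : ℝ}
    (h0 : 0 ≤ t) (ht : (t : EReal) < T) :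
    ‖WithLp.toLp 2 (∑ i, x i t)‖ ≤ ‖WithLp.toLp 2 (∑ i, x i 0)‖ * Real.exp (‖S.A‖ * t) := by
  have hI := Icc_subset le_rfl ht
  have := norm_toLp_le_gronwallBound (A := S.A) (v := fun r => ∑ i, x i r) (g := fun _ => 0)
    (a := 0) (b := t) (ε := 0)
    (continuousOn_finsetSum _ fun i _ => (h.x_cont i).mono hI) ?_ (by simp) t ⟨h0, le_rfl⟩
  · rwa [gronwallBound_ε0, sub_zero] at this
  · intro r hr
    obtain ⟨hr0, hrT⟩ := hI (Ico_subset_Icc_self hr)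
    have hd := HasDerivWithinAt.fun_sum fun i (_ : i ∈ Finset.univ) => h.x_ode i r hr0 hrT
    convert! hd using 1
    rw [Finset.sum_add_distrib, ← Matrix.mulVec_sum, ← Matrix.mulVec_sum, ← Matrix.mulVec_sum,
      sum_coupling_eq_zero (fun i j => h.coupling_symm hS i j hr0 hrT) (fun i => xt i r),
      Matrix.mulVec_zero, Matrix.mulVec_zero]

end IsExecution

end ConsensusNetwork

/-! ### Boundedness of the energy -/

namespace ConsensusNetwork

open Set Filter Topology

variable {N n m : ℕ} {S : ConsensusNetwork N n m}

namespace IsExecution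

variable {T : EReal} {x : Fin N → ℝ → Fin n → ℝ} {c : Fin N → Fin N → ℝ → ℝ}
  {ev : Fin N → ℕ → EReal} {xt : Fin N → ℝ → Fin n → ℝ} {seen : Fin N → Fin N → ℝ → Fin n → ℝ}

/-- The energy decays up to terms in the broadcast disagreement, whose coefficient is made negative
by a large `α`, and in the sampling errors. -/
theorem exists_energy_dissipation (hS : S.IsDesigned) (h : S.IsExecution T x c ev xt seen)
    {C₀ : ℝ} (hC₀ : 0 ≤ C₀) :
    ∃ l H₁ H₂ : ℝ, 0 < l ∧ 0 ≤ H₂ ∧ ∀ α : ℝ, ∃ C : ℝ, ∀ t : ℝ, 0 ≤ t → (t : EReal) < T →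
      (∀ i j, S.G.Adj i j → -C₀ ≤ c i j t) →
      ∃ D : ℝ, HasDerivWithinAt
          (fun r => S.energy α (fun i => x i r) (fun i j => c i j r)) D (Ici t) t ∧
        D ≤ -(l * S.energy α (fun i => x i t) (fun i j => c i j t)) +
          ∑ i, ∑ j, S.a i j * ((H₁ - N * α / 4) * ‖S.gain (xt i t) - S.gain (xt j t)‖ ^ 2 +
            H₂ * ‖S.gain (xt i t) - S.gain (x i t)‖ ^ 2) + C := by
  obtain ⟨G, hG₀, hG⟩ := hS.connected.exists_sum_norm_sub_sq_le (EuclideanSpace ℝ (Fin m))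
    S.a_nonneg (fun i j hij => a_of_adj hij)
  obtain ⟨l, hl, hdecay⟩ := hS.exists_decay_rate
  refine ⟨l, N * (C₀ / 2 + 1 / (4 * S.δ)) + 3 / 4 * G, 2 * N * C₀ + 3 / 2 * G, hl,
    by positivity, fun α => ⟨(N : ℝ) ^ 2 * S.μ / S.δ + N / 8 * ∑ i, ∑ j, S.a i j *
      (S.ϱ i j * α ^ 2), fun t h0 ht hc => ⟨_, h.hasDerivWithinAt_energy hS α h0 ht, ?_⟩⟩⟩
  have htrig := h.trigger_le hS
  simp only [gain_sub] at htrig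
  have hdiss := consensus_dissipation (a := S.a) (c := fun i j => c i j t) (ϱ := S.ϱ)
    (α := α) (y := fun i => S.gain (x i t)) (η := fun i => S.gain (xt i t))
    S.a_nonneg S.a_symm (fun i j => h.coupling_symm hS i j h0 ht)
    (fun i j hij => hc i j (adj_of_a_ne_zero hij)) hC₀ hS.δ_pos
    (fun i => htrig i h0 ht) hG₀ (hG _)
  rw [Fintype.card_fin] at hdiss
  have hdec := hdecay α (fun i => x i t) (fun i j => c i j t)
  -- From `(c - α) c = ½(c - α)² + ½c² - ½α²`, dropping the `c²` term.
  have hleak : -((N : ℝ) / 4 * ∑ i, ∑ j, S.a i j * (S.ϱ i j * (c i j t - α) * c i j t)) ≤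
      -(N / 8 * ∑ i, ∑ j, S.a i j * (S.ϱ i j * (c i j t - α) ^ 2)) +
        N / 8 * ∑ i, ∑ j, S.a i j * (S.ϱ i j * α ^ 2) := by
    simp_rw [Finset.mul_sum, ← Finset.sum_neg_distrib, ← Finset.sum_add_distrib]
    refine Finset.sum_le_sum fun i _ => Finset.sum_le_sum fun j _ => ?_
    by_cases hij : S.G.Adj i j
    · rw [a_of_adj hij]
      have h1 : 0 ≤ (N : ℝ) * S.ϱ i j * c i j t ^ 2 :=
        mul_nonneg (mul_nonneg hS.card_pos.le (hS.ϱ_pos i j hij).le) (sq_nonneg _)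
      nlinarith [h1]
    · simp [a_of_not_adj hij]
  linarith

/-- Once no weight is too negative, the energy stays bounded. -/
theorem exists_energy_le_of_le_weight (hS : S.IsDesigned)
    (h : S.IsExecution T x c ev xt seen) {t₁ : ℝ} (ht₁ : 0 ≤ t₁)
    (hc : ∀ t : ℝ, t₁ ≤ t → (t : EReal) < T → ∀ i j, S.G.Adj i j → -(1 / (2 * S.δ)) ≤ c i j t) :
    ∃ α W : ℝ, ∀ t : ℝ, t₁ ≤ t → (t : EReal) < T →
      S.energy α (fun i => x i t) (fun i j => c i j t) ≤ W := by
  have hδ := hS.δ_pos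
  have hN := hS.card_pos
  obtain ⟨l, H₁, H₂, hl, hH₂, hdiss⟩ :=
    h.exists_energy_dissipation hS (C₀ := 1 / (2 * S.δ)) (by positivity)
  -- With `1 + δ c ≥ 1/2` the rule gives `H₂ ∑ aᵢⱼ‖K eᵢ‖² ≤ (H₂/2) ∑ aᵢⱼ‖K(x̃ᵢ - x̃ⱼ)‖² + 2 H₂ μ`
  -- for each agent; this `α` makes the available coefficient exactly `-H₂/2`.
  set α : ℝ := 4 * (H₁ + H₂ / 2) / N with hα
  have hαN : H₁ - N * α / 4 = -(H₂ / 2) := by rw [hα]; field_simp; ring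
  obtain ⟨C, hC⟩ := hdiss α
  have hsample : ∀ t : ℝ, t₁ ≤ t → (t : EReal) < T →
      ∑ i, ∑ j, S.a i j * ((H₁ - N * α / 4) * ‖S.gain (xt i t) - S.gain (xt j t)‖ ^ 2 +
            H₂ * ‖S.gain (xt i t) - S.gain (x i t)‖ ^ 2) ≤ ∑ _i : Fin N, 2 * H₂ * S.μ := by
    intro t ht htT
    refine Finset.sum_le_sum fun i _ => ?_
    have htrig := h.trigger_le hS i (ht₁.trans ht) htT
    simp only [gain_sub] at htrig
    have h1 : 1 / 2 * ∑ j, S.a i j * ‖S.gain (xt i t) - S.gain (x i t)‖ ^ 2 ≤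
        ∑ j, (1 + S.δ * c i j t) * S.a i j * ‖S.gain (xt i t) - S.gain (x i t)‖ ^ 2 := by
      rw [Finset.mul_sum]
      refine Finset.sum_le_sum fun j _ => ?_
      by_cases hij : S.G.Adj i j
      · rw [a_of_adj hij, one_mul, mul_one]
        have h2 := mul_le_mul_of_nonneg_left (hc t ht htT i j hij) hδ.le
        have h3 : S.δ * -(1 / (2 * S.δ)) = -(1 / 2) := by field_simp
        exact mul_le_mul_of_nonneg_right (by linarith) (sq_nonneg _)
      · simp [a_of_not_adj hij]
    have h4 : ∑ j, S.a i j * ((H₁ - N * α / 4) * ‖S.gain (xt i t) - S.gain (xt j t)‖ ^ 2 +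
            H₂ * ‖S.gain (xt i t) - S.gain (x i t)‖ ^ 2) =
        -(H₂ / 2) * ∑ j, S.a i j * ‖S.gain (xt i t) - S.gain (xt j t)‖ ^ 2 +
          H₂ * ∑ j, S.a i j * ‖S.gain (xt i t) - S.gain (x i t)‖ ^ 2 := by
      rw [hαN, Finset.mul_sum, Finset.mul_sum, ← Finset.sum_add_distrib]
      exact Finset.sum_congr rfl fun j _ => by ring
    rw [h4]
    nlinarith [mul_le_mul_of_nonneg_left (h1.trans htrig) hH₂]
  set C' := ∑ _i : Fin N, 2 * H₂ * S.μ + C with hC'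
  set V : ℝ → ℝ := fun r => S.energy α (fun i => x i r) (fun i j => c i j r) with hV
  -- Wherever `V = W`, its derivative is at most `-l W + C' < 0`.
  set W : ℝ := max (V t₁) (C' / l + 1) with hW
  refine ⟨α, W, fun t ht htT => ?_⟩
  have hI : Icc t₁ t ⊆ {t : ℝ | 0 ≤ t ∧ (t : EReal) < T} := Icc_subset ht₁ htT
  choose! D hD hDle using fun r (hr : r ∈ Ico t₁ t) =>
    hC r (hI (Ico_subset_Icc_self hr)).1 (hI (Ico_subset_Icc_self hr)).2
      (hc r hr.1 (hI (Ico_subset_Icc_self hr)).2)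
  refine le_of_deriv_right_lt_of_running_le (f := V) (f' := D) (W := fun _ => W)
    (W' := fun _ => 0) ((h.continuousOn_energy α).mono hI) hD continuousOn_const
    (fun r _ => hasDerivWithinAt_const r _ _) (le_max_left _ _) (fun r hr _ hVr => ?_) t
    ⟨ht, le_rfl⟩
  have h1 := hDle r hr
  have h2 := hsample r hr.1 (hI (Ico_subset_Icc_self hr)).2
  have h3 : C' < l * W := by
    have : C' / l < W := (lt_add_one _).trans_le (le_max_right _ _)
    rwa [div_lt_iff₀' hl] at this
  have h4 : S.energy α (fun i => x i r) (fun i j => c i j r) = W := hVr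
  rw [h4] at h1
  linarith

theorem exists_weight_le_of_le_weight (hS : S.IsDesigned)
    (h : S.IsExecution T x c ev xt seen) {t₁ : ℝ} (ht₁ : 0 ≤ t₁) (ht₁T : (t₁ : EReal) < T)
    (hc : ∀ t : ℝ, t₁ ≤ t → (t : EReal) < T → ∀ i j, S.G.Adj i j → -(1 / (2 * S.δ)) ≤ c i j t)
    (i j : Fin N) (hij : S.G.Adj i j) :
    ∃ cbar : ℝ, ∀ t : ℝ, 0 ≤ t → (t : EReal) < T → |c i j t| ≤ cbar := by
  obtain ⟨α, W, hW⟩ := h.exists_energy_le_of_le_weight hS ht₁ hc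
  obtain ⟨M, hM⟩ := isCompact_Icc.exists_bound_of_continuousOn
    ((h.c_cont i j).mono (Icc_subset le_rfl ht₁T))
  refine ⟨max M (|α| + 1 + 8 * S.κ i j * W), fun t h0 ht => ?_⟩
  rcases le_total t t₁ with hle | hle
  · exact (hM t ⟨h0, hle⟩).trans (le_max_left _ _)
  · refine le_trans ?_ (le_max_right _ _)
    have h1 := hS.abs_weight_le α (fun i => x i t) (fun i j => c i j t) hij
    have h2 := mul_le_mul_of_nonneg_left (hW t hle ht)
      (mul_pos (by norm_num : (0 : ℝ) < 8) (hS.κ_pos i j hij)).le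
    linarith

/-- On an unbounded time interval the weights are bounded. -/
theorem exists_weight_le_of_eq_top (hS : S.IsDesigned) (h : S.IsExecution T x c ev xt seen)
    (hT : T = ⊤) (i j : Fin N) (hij : S.G.Adj i j) :
    ∃ cbar : ℝ, ∀ t : ℝ, 0 ≤ t → (t : EReal) < T → |c i j t| ≤ cbar := by
  have hlt : ∀ t : ℝ, (t : EReal) < T := fun t => hT ▸ EReal.coe_lt_top t
  have hδ : 0 < 1 / (2 * S.δ) := by have := hS.δ_pos; positivity
  have hev : ∀ᶠ t : ℝ in atTop, ∀ i j, S.G.Adj i j → -(1 / (2 * S.δ)) ≤ c i j t := by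
    refine eventually_all.2 fun i => eventually_all.2 fun j => ?_
    by_cases hij : S.G.Adj i j
    · have hl : 0 < S.κ i j * S.ϱ i j := mul_pos (hS.κ_pos i j hij) (hS.ϱ_pos i j hij)
      have hlim : Tendsto (fun t => |c i j 0| * Real.exp (-(S.κ i j * S.ϱ i j * t))) atTop
          (𝓝 (|c i j 0| * 0)) :=
        (Real.tendsto_exp_neg_atTop_nhds_zero.comp
          (tendsto_id.const_mul_atTop hl)).const_mul _
      rw [mul_zero] at hlim
      filter_upwards [hlim.eventually (gt_mem_nhds hδ), eventually_ge_atTop 0] with t ht h0 _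
      linarith [h.neg_abs_le_weight hS hij h0 (hlt t)]
    · exact Eventually.of_forall fun t hadj => absurd hadj hij
  obtain ⟨t₁, ht₁⟩ := eventually_atTop.1 hev
  exact h.exists_weight_le_of_le_weight hS (le_max_right t₁ 0) (hlt _)
    (fun t ht _ => ht₁ t ((le_max_left _ _).trans ht)) i j hij

/-- A state is the mean plus the average of its disagreements: the mean grows at most like
`e^{‖A‖t}`, and positivity of `P` bounds the disagreements by the energy. Only the disagreement part
enters, so the constants do not depend on `α`. -/
theorem exists_norm_state_le (hS : S.IsDesigned) (h : S.IsExecution T x c ev xt seen) {b : ℝ}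
    (hT : T = b) :
    ∃ R₁ R₂ : ℝ, 0 ≤ R₁ ∧ 0 ≤ R₂ ∧ ∀ (α t : ℝ), 0 ≤ t → (t : EReal) < T → ∀ i,
      ‖WithLp.toLp 2 (x i t)‖ ^ 2 ≤
        R₁ + R₂ * S.energy α (fun i => x i t) (fun i j => c i j t) := by
  obtain ⟨Cp, hCp, hP⟩ := hS.posDef.exists_norm_sq_le
  have hN := hS.card_pos
  set M := ‖WithLp.toLp 2 (∑ i, x i 0)‖ * Real.exp (‖S.A‖ * b) with hM
  refine ⟨2 * (M / N) ^ 2, 8 * Cp, by positivity, by positivity, fun α t h0 ht i => ?_⟩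
  have htb : t ≤ b := by rw [hT] at ht; exact (EReal.coe_lt_coe_iff.1 ht).le
  set V := S.energy α (fun i => x i t) (fun i j => c i j t) with hV
  have hV0 : 0 ≤ V := hS.energy_nonneg _ _ _
  have hm : ‖WithLp.toLp 2 (∑ i, x i t)‖ ≤ M :=
    (h.norm_sum_state_le hS h0 ht).trans (mul_le_mul_of_nonneg_left
      (Real.exp_le_exp.2 (mul_le_mul_of_nonneg_left htb (norm_nonneg _))) (norm_nonneg _))
  have hd : ∀ j, ‖WithLp.toLp 2 (x i t - x j t)‖ ≤ √(4 * Cp * V) := fun j => by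
    refine Real.le_sqrt_of_sq_le ((hP _).trans ?_)
    have := hS.disagreement_le_energy α (fun i => x i t) (fun i j => c i j t) i j
    nlinarith [mul_le_mul_of_nonneg_left this hCp.le]
  have hsum : (N : ℝ) • x i t = ∑ j, x j t + ∑ j, (x i t - x j t) := by
    rw [← Finset.sum_add_distrib]
    simp only [add_sub_cancel, Finset.sum_const, Finset.card_univ, Fintype.card_fin]
    rw [Nat.cast_smul_eq_nsmul]
  have hnorm : N * ‖WithLp.toLp 2 (x i t)‖ ≤ M + N * √(4 * Cp * V) := by
    have h1 : N * ‖WithLp.toLp 2 (x i t)‖ = ‖WithLp.toLp 2 ((N : ℝ) • x i t)‖ := by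
      rw [WithLp.toLp_smul, norm_smul, Real.norm_of_nonneg hN.le]
    rw [h1, hsum, WithLp.toLp_add]
    refine (norm_add_le _ _).trans (add_le_add hm ?_)
    rw [WithLp.toLp_sum]
    refine (norm_sum_le _ _).trans ?_
    refine (Finset.sum_le_sum fun j _ => hd j).trans_eq ?_
    rw [Finset.sum_const, Finset.card_univ, Fintype.card_fin, nsmul_eq_mul]
  have hnorm' : ‖WithLp.toLp 2 (x i t)‖ ≤ M / N + √(4 * Cp * V) := by
    rw [← mul_le_mul_iff_right₀ hN, mul_add, mul_div_cancel₀ _ hN.ne']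
    exact hnorm
  have hsq : √(4 * Cp * V) ^ 2 = 4 * Cp * V := Real.sq_sqrt (by positivity)
  have h2 := pow_le_pow_left₀ (norm_nonneg _) hnorm' 2
  nlinarith [sq_nonneg (M / N - √(4 * Cp * V))]

/-- On a bounded time interval the energy is bounded. -/
theorem exists_energy_le_of_eq_coe (hS : S.IsDesigned) (h : S.IsExecution T x c ev xt seen)
    {b : ℝ} (hT : T = b) :
    ∃ α W : ℝ, ∀ t : ℝ, 0 ≤ t → (t : EReal) < T →
      S.energy α (fun i => x i t) (fun i j => c i j t) ≤ W := by
  have hN := hS.card_pos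
  set C₀ := ∑ i, ∑ j, |c i j 0| with hC₀
  have hC₀0 : 0 ≤ C₀ := Finset.sum_nonneg fun i _ => Finset.sum_nonneg fun j _ => abs_nonneg _
  have hc : ∀ t : ℝ, 0 ≤ t → (t : EReal) < T → ∀ i j, S.G.Adj i j → -C₀ ≤ c i j t := by
    intro t h0 ht i j hij
    have h1 : |c i j 0| ≤ C₀ :=
      (Finset.single_le_sum (f := fun j => |c i j 0|) (fun j _ => abs_nonneg _)
        (Finset.mem_univ j)).trans
        (Finset.single_le_sum (f := fun i => ∑ j, |c i j 0|)
          (fun i _ => Finset.sum_nonneg fun j _ => abs_nonneg _) (Finset.mem_univ i))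
    have h2 : |c i j 0| * Real.exp (-(S.κ i j * S.ϱ i j * t)) ≤ |c i j 0| := by
      refine mul_le_of_le_one_right (abs_nonneg _) (Real.exp_le_one_iff.2 ?_)
      have := mul_nonneg (mul_pos (hS.κ_pos i j hij) (hS.ϱ_pos i j hij)).le h0
      linarith
    linarith [h.neg_abs_le_weight hS hij h0 ht]
  obtain ⟨l, H₁, H₂, hl, hH₂, hdiss⟩ := h.exists_energy_dissipation hS hC₀0
  obtain ⟨R₁, R₂, hR₁, hR₂, hR⟩ := h.exists_norm_state_le hS hT
  -- The broadcast term only has to vanish here: the errors are bounded through past states instead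
  -- of the triggering rule.
  set α : ℝ := 4 * H₁ / N with hα
  have hαN : H₁ - N * α / 4 = 0 := by rw [hα]; field_simp; ring
  obtain ⟨C, hC⟩ := hdiss α
  set V : ℝ → ℝ := fun r => S.energy α (fun i => x i r) (fun i j => c i j r) with hV
  have hV0 : ∀ r, 0 ≤ V r := fun r => hS.energy_nonneg _ _ _
  set Q : ℝ := (‖S.K‖ * (Real.exp (‖S.A‖ * b) + 1)) ^ 2 with hQ
  have hQ0 : 0 ≤ Q := sq_nonneg _
  set E : ℝ := ∑ i, ∑ j, S.a i j * (H₂ * Q) with hE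
  have hE0 : 0 ≤ E := Finset.sum_nonneg fun i _ => Finset.sum_nonneg fun j _ =>
    mul_nonneg (S.a_nonneg i j) (mul_nonneg hH₂ hQ0)
  -- Since `W ≥ 1`, this rate gives `W' = L W > E (R₁ + R₂ W) + C`.
  set L : ℝ := E * (R₁ + R₂) + |C| + 1 with hL
  have hL0 : 0 ≤ L := by positivity
  set W : ℝ → ℝ := fun r => (V 0 + 1) * Real.exp (L * r) with hW
  have hWder : ∀ r, HasDerivAt W ((V 0 + 1) * (Real.exp (L * r) * L)) r := fun r => by
    have := (((hasDerivAt_id r).const_mul L).exp).const_mul (V 0 + 1)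
    simpa using this
  have hWmono : ∀ s r, s ≤ r → W s ≤ W r := fun s r hsr =>
    mul_le_mul_of_nonneg_left (Real.exp_le_exp.2 (mul_le_mul_of_nonneg_left hsr hL0))
      (by linarith [hV0 0])
  have hsample : ∀ t : ℝ, 0 ≤ t → (t : EReal) < T → (∀ s ∈ Icc 0 t, V s ≤ W s) →
      ∑ i, ∑ j, S.a i j * ((H₁ - N * α / 4) * ‖S.gain (xt i t) - S.gain (xt j t)‖ ^ 2 +
            H₂ * ‖S.gain (xt i t) - S.gain (x i t)‖ ^ 2) ≤ E * (R₁ + R₂ * W t) := by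
    intro t h0 ht hle
    have htb : t ≤ b := by rw [hT] at ht; exact (EReal.coe_lt_coe_iff.1 ht).le
    have hWt : 0 ≤ W t := (hV0 t).trans (hle t ⟨h0, le_rfl⟩)
    rw [hE, Finset.sum_mul]
    refine Finset.sum_le_sum fun i _ => ?_
    rw [Finset.sum_mul]
    refine Finset.sum_le_sum fun j _ => ?_
    rw [hαN, zero_mul, zero_add, mul_assoc, mul_assoc]
    refine mul_le_mul_of_nonneg_left (mul_le_mul_of_nonneg_left ?_ hH₂) (S.a_nonneg i j)
    -- The last sample may lie anywhere in the past, so the bound `V ≤ W` is needed on all of `[0,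
    -- t]`; monotonicity of `W` then moves it to time `t`.
    have hpast : ∀ s ∈ Icc 0 t, ‖WithLp.toLp 2 (x i s)‖ ≤ √(R₁ + R₂ * W t) := by
      intro s hs
      refine Real.le_sqrt_of_sq_le ((hR α s hs.1 (Icc_subset le_rfl ht hs).2 i).trans ?_)
      exact add_le_add_right (mul_le_mul_of_nonneg_left
        ((hle s hs).trans (hWmono s t hs.2)) hR₂) R₁
    have hxt : ‖WithLp.toLp 2 (xt i t)‖ ≤ √(R₁ + R₂ * W t) * Real.exp (‖S.A‖ * b) :=
      (h.norm_xt_le i h0 ht hpast).trans (mul_le_mul_of_nonneg_left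
        (Real.exp_le_exp.2 (mul_le_mul_of_nonneg_left htb (norm_nonneg _))) (Real.sqrt_nonneg _))
    have hg : ‖S.gain (xt i t) - S.gain (x i t)‖ ≤
        ‖S.K‖ * (Real.exp (‖S.A‖ * b) + 1) * √(R₁ + R₂ * W t) := by
      rw [← gain_sub]
      refine (S.norm_gain_le _).trans ?_
      rw [mul_assoc]
      refine mul_le_mul_of_nonneg_left ?_ (norm_nonneg _)
      rw [WithLp.toLp_sub]
      refine (norm_sub_le _ _).trans ?_
      linarith [hpast t ⟨h0, le_rfl⟩]
    have h2 := pow_le_pow_left₀ (norm_nonneg _) hg 2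
    rwa [mul_pow, Real.sq_sqrt (by positivity), ← hQ] at h2
  refine ⟨α, W b, fun t h0 ht => ?_⟩
  have hI : Icc 0 t ⊆ {t : ℝ | 0 ≤ t ∧ (t : EReal) < T} := Icc_subset le_rfl ht
  have htb : t ≤ b := by rw [hT] at ht; exact (EReal.coe_lt_coe_iff.1 ht).le
  choose! D hD hDle using fun r (hr : r ∈ Ico 0 t) =>
    hC r (hI (Ico_subset_Icc_self hr)).1 (hI (Ico_subset_Icc_self hr)).2
      (hc r hr.1 (hI (Ico_subset_Icc_self hr)).2)
  refine (le_of_deriv_right_lt_of_running_le (f := V) (f' := D) (W := W)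
    ((h.continuousOn_energy α).mono hI) hD
    (fun r _ => (hWder r).continuousAt.continuousWithinAt)
    (fun r _ => (hWder r).hasDerivWithinAt) (by simp [hW]) (fun r hr hle hVr => ?_) t
    ⟨h0, le_rfl⟩).trans (hWmono t b htb)
  have h1 := hDle r hr
  have h2 := hsample r hr.1 (hI (Ico_subset_Icc_self hr)).2 hle
  have h3 : 1 ≤ W r := by
    have : 1 ≤ W 0 := by simp only [hW, mul_zero, Real.exp_zero, mul_one]; linarith [hV0 0]
    exact this.trans (hWmono 0 r hr.1)
  have h4 := mul_nonneg hl.le (hV0 r)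
  have h5 : E * (R₁ + R₂ * W r) + C < W r * L := by
    have e1 : E * R₁ ≤ E * R₁ * W r := le_mul_of_one_le_right (mul_nonneg hE0 hR₁) h3
    have e2 : C ≤ |C| * W r :=
      (le_abs_self C).trans (le_mul_of_one_le_right (abs_nonneg C) h3)
    rw [hL]
    linarith
  have h6 : (V 0 + 1) * (Real.exp (L * r) * L) = W r * L := by simp only [hW]; ring
  rw [h6]
  linarith

end IsExecution

end ConsensusNetwork

/-! ### Bounded weights and absence of Zeno behavior -/

namespace ConsensusNetwork

open Set Filter Topology

variable {N n m : ℕ} {S : ConsensusNetwork N n m}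

namespace IsExecution

variable {T : EReal} {x : Fin N → ℝ → Fin n → ℝ} {c : Fin N → Fin N → ℝ → ℝ}
  {ev : Fin N → ℕ → EReal} {xt : Fin N → ℝ → Fin n → ℝ} {seen : Fin N → Fin N → ℝ → Fin n → ℝ}

theorem eq_top_or_exists_eq_coe (h : S.IsExecution T x c ev xt seen) :
    T = ⊤ ∨ ∃ b : ℝ, T = b := by
  have hT := h.T_pos
  induction T with
  | bot => simp at hT
  | top => exact Or.inl rfl
  | coe b => exact Or.inr ⟨b, rfl⟩

/-- The coupling weights are bounded. -/
theorem exists_weight_bound (hS : S.IsDesigned) (h : S.IsExecution T x c ev xt seen) :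
    ∃ cbar : ℝ, 0 < cbar ∧
      ∀ i j, S.G.Adj i j → ∀ t : ℝ, 0 ≤ t → (t : EReal) < T → |c i j t| ≤ cbar := by
  have hedge : ∀ i j, ∃ cbar : ℝ, S.G.Adj i j →
      ∀ t : ℝ, 0 ≤ t → (t : EReal) < T → |c i j t| ≤ cbar := by
    intro i j
    by_cases hij : S.G.Adj i j
    · rcases h.eq_top_or_exists_eq_coe with hT | ⟨b, hT⟩
      · obtain ⟨M, hM⟩ := h.exists_weight_le_of_eq_top hS hT i j hij
        exact ⟨M, fun _ => hM⟩
      · obtain ⟨α, W, hW⟩ := h.exists_energy_le_of_eq_coe hS hT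
        refine ⟨|α| + 1 + 8 * S.κ i j * W, fun _ t h0 ht => ?_⟩
        have h1 := hS.abs_weight_le α (fun i => x i t) (fun i j => c i j t) hij
        have h2 := mul_le_mul_of_nonneg_left (hW t h0 ht)
          (mul_pos (by norm_num : (0 : ℝ) < 8) (hS.κ_pos i j hij)).le
        linarith
    · exact ⟨0, fun hadj => absurd hadj hij⟩
  choose M hM using hedge
  have hle : ∀ i j, |M i j| ≤ ∑ i, ∑ j, |M i j| := fun i j =>
    (Finset.single_le_sum (f := fun j => |M i j|) (fun j _ => abs_nonneg _)
      (Finset.mem_univ j)).trans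
      (Finset.single_le_sum (f := fun i => ∑ j, |M i j|)
        (fun i _ => Finset.sum_nonneg fun j _ => abs_nonneg _) (Finset.mem_univ i))
  refine ⟨∑ i, ∑ j, |M i j| + 1, ?_, fun i j hij t h0 ht => ?_⟩
  · have : 0 ≤ ∑ i, ∑ j, |M i j| :=
      Finset.sum_nonneg fun i _ => Finset.sum_nonneg fun j _ => abs_nonneg _
    linarith
  · linarith [hM i j hij t h0 ht, le_abs_self (M i j), hle i j]

theorem exists_inputSize_le_of_eq_coe (hS : S.IsDesigned) (h : S.IsExecution T x c ev xt seen)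
    {b : ℝ} (hT : T = b) (i : Fin N) :
    ∃ σ : ℝ, ∀ t : ℝ, 0 ≤ t → (t : EReal) < T → S.inputSize xt i t ≤ σ := by
  obtain ⟨α, W, hW⟩ := h.exists_energy_le_of_eq_coe hS hT
  obtain ⟨R₁, R₂, -, hR₂, hR⟩ := h.exists_norm_state_le hS hT
  have hx : ∀ j, ∀ t : ℝ, 0 ≤ t → (t : EReal) < T →
      ‖WithLp.toLp 2 (x j t)‖ ≤ √(R₁ + R₂ * W) := fun j t h0 ht =>
    Real.le_sqrt_of_sq_le ((hR α t h0 ht j).trans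
      (add_le_add_right (mul_le_mul_of_nonneg_left (hW t h0 ht) hR₂) R₁))
  refine ⟨S.deg i * ‖S.B * S.K‖ * (2 * (√(R₁ + R₂ * W) * Real.exp (‖S.A‖ * b))),
    fun t h0 ht => S.inputSize_le fun j => ?_⟩
  have htb : t ≤ b := by rw [hT] at ht; exact (EReal.coe_lt_coe_iff.1 ht).le
  refine (h.norm_xt_le j h0 ht fun s hs =>
    hx j s hs.1 (Icc_subset le_rfl ht hs).2).trans ?_
  exact mul_le_mul_of_nonneg_left (Real.exp_le_exp.2
    (mul_le_mul_of_nonneg_left htb (norm_nonneg _))) (Real.sqrt_nonneg _)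

/-- No Zeno behavior. -/
theorem finite_events (hS : S.IsDesigned) (h : S.IsExecution T x c ev xt seen) (i : Fin N)
    (t : ℝ) : {k : ℕ | ev i k ≤ t}.Finite := by
  rcases h.eq_top_or_exists_eq_coe with hT | ⟨b, hT⟩
  -- For `T = ∞` every real time lies in a covering interval, which caps the event index.
  · exact h.finite_events_of_lt i (hT ▸ EReal.coe_lt_top t)
  · obtain ⟨cbar, hcbar, hc⟩ := h.exists_weight_bound hS
    obtain ⟨σ, hσ⟩ := h.exists_inputSize_le_of_eq_coe hS hT i
    exact h.finite_events_of_bounded hS i hT.le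
      (fun r h0 hr j hij => hc i j hij r h0 hr) hσ hcbar.le t

end IsExecution

end ConsensusNetwork

theorem theorem2 {N n m : ℕ} (S : ConsensusNetwork N n m) (hS : S.IsDesigned)
    (T : EReal) (x : Fin N → ℝ → Fin n → ℝ) (c : Fin N → Fin N → ℝ → ℝ) (ev : Fin N → ℕ → EReal)
    (xt : Fin N → ℝ → Fin n → ℝ) (seen : Fin N → Fin N → ℝ → Fin n → ℝ)
    (h : S.IsExecution T x c ev xt seen) :
    -- no Zeno behavior: each agent has finitely many events in any bounded period of time
    (∀ (i : Fin N) (t : ℝ), {k : ℕ | ev i k ≤ t}.Finite) ∧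
    -- the coupling weights are bounded by a positive constant
    (∃ cbar : ℝ, 0 < cbar ∧ ∀ i j, S.G.Adj i j → ∀ t : ℝ, 0 ≤ t → t < T → |c i j t| ≤ cbar) ∧
    -- between two consecutive events of an agent ...
    (∀ (i : Fin N) (k : ℕ), ev i (k + 1) < T →
      -- ... its input magnitude is bounded by a positive constant
      (∃ σ : ℝ, 0 < σ ∧
        ∀ t : ℝ, ev i k ≤ t → t < ev i (k + 1) → S.inputSize xt i t ≤ σ) ∧
      -- ... and any such bounds yield an explicit positive lower bound of the inter-event interval
      ∀ cbar σ : ℝ,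
        (∀ t : ℝ, ev i k ≤ t → t < ev i (k + 1) → ∀ j, S.G.Adj i j → |c i j t| ≤ cbar) →
        (∀ t : ℝ, ev i k ≤ t → t < ev i (k + 1) → S.inputSize xt i t ≤ σ) →
        ∃ τ : ℝ, 0 < τ ∧ τ = S.tauRhs i cbar σ (ev i k).toReal τ ∧
          ev i k + (τ : EReal) ≤ ev i (k + 1)) := by
  refine ⟨h.finite_events hS, h.exists_weight_bound hS, fun i k hk => ?_⟩
  obtain ⟨t, -, htT, ht⟩ := h.exists_ev_eq_coe i (k + 1) (hk.trans_le le_top).ne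
  obtain ⟨s, hs0, -, hs⟩ := h.exists_ev_eq_coe i k
    ((h.ev_le_succ i k).trans_lt (ht ▸ EReal.coe_lt_top t)).ne
  rw [hs, ht, EReal.toReal_coe]
  refine ⟨?_, fun cbar σ hc hσ => ?_⟩
  · obtain ⟨σ, hσ, hbound⟩ := h.exists_inputSize_le i htT
    exact ⟨σ, hσ, fun r hr hrt => hbound r
      ⟨hs0.trans (EReal.coe_le_coe_iff.1 hr), (EReal.coe_lt_coe_iff.1 hrt).le⟩⟩
  · obtain ⟨τ, hτ, hτeq, hle⟩ := h.exists_interevent_bound hS i hs ht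
      (fun r hr => hc r (EReal.coe_le_coe_iff.2 hr.1) (EReal.coe_lt_coe_iff.2 hr.2))
      (fun r hr => hσ r (EReal.coe_le_coe_iff.2 hr.1) (EReal.coe_lt_coe_iff.2 hr.2))
    exact ⟨τ, hτ, hτeq, by exact_mod_cast hle⟩
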